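/- Equip $\mathbb R^{2,1}=\mathbb R^3$ with $\langle x,y\rangle=x_1y_1+x_2y_2-x_3y_3$. Let $\mathfrak F$ be the circle of future-pointing lightlike rays (those with $x_3>0$), and order triples of rays by saying that $x,y,z$ are in counterclockwise order when $\det[x\,y\,z]>0$. A hyperbolic $g\in SO(2,1)^0$ (three distinct eigenvalues, which are then $\lambda<1<\lambda^{-1}$ with $\lambda>0$) has future-pointing lightlike eigenvectors $x^-_g$, $x^+_g$ of Euclidean length one for $\lambda$, $\lambda^{-1}$, and a $1$-eigenvector $x^0_g$ with $\langle x^0_g,x^0_g\rangle=1$ and $\det[x^0_g\,x^-_g\,x^+_g]>0$. The Margulis invariant of an affine map $\gamma(x)=gx+v$ with hyperbolic linear part $g$ is $\alpha(\gamma)=\langle v,x^0_g\rangle$. Let $g,h\in SO(2,1)^0$ be Schottky generators of $G=\langle g,h\rangle$: there are four pairwise disjoint closed intervals $A_g^\pm,A_h^\pm\subset\mathfrak F$ with $g(A_g^-)=\overline{\mathfrak F\setminus A_g^+}$ and $h(A_h^-)=\overline{\mathfrak F\setminus A_h^+}$. Assume that $G$ is transversal: the planes $(x^0_g)^\perp$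 and $(x^0_h)^\perp$ intersect in a timelike line (geometrically, $G$ is the fundamental group of a punctured torus). Replacing $h$ by $h^{-1}$ if necessary, let $x^-_g,x^-_h,x^+_g$ be in counterclockwise order. Assume Property C: if $A$ denotes the closed interval contained in $A_g^+$ and bounded by the rays of $x^+_{gh}$ and $g(x^+_h)$, then $$-\langle x,x^0_{w_1}\rangle<\langle x,x^0_{w_2}\rangle$$ for every $x$ on a ray of $A$, every cyclically reduced word $w_1$ of the form $gh^ig^{-1}w$ with $i\ge1$, and every cyclically reduced word $w_2$ of the form $gh^{-i}g^{-1}w$ with $i\ge1$. Then for every $n\ge1$ there are affine isometries $\gamma,\eta$ with linear parts $g,h$ such that every non-trivial reduced word of length at most $n$ in $\gamma^{\pm1},\eta^{\pm1}$ has hyperbolic linear part and positive Margulis invariant, while $\alpha(\gamma\eta^n)<0$, and such that the group $\langle\gamma,\eta\rangle$ does not act properly on $\mathbb A^{2,1}$. -/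

import Mathlib

noncomputable section

namespace FlatLorentz

/-! ### The Lorentzian vector space and its future lightcone -/

/-- The underlying space of `ℝ^{2,1}`, identified with the affine space `𝔸^{2,1}`. -/
abbrev R21 : Type := Fin 3 → ℝ

/-- The Lorentzian bilinear form of signature `(2,1)`. -/
def ldot (x y : R21) : ℝ := x 0 * y 0 + x 1 * y 1 - x 2 * y 2

/-- The determinant `det [u v w]`. -/
def det3 (u v w : R21) : ℝ := Matrix.det (Matrix.of ![u, v, w])

/-- The future-pointing (nonzero) lightlike vectors. A set of future-pointing lightlike rays is
represented by the union of its rays, a subset of `future` stable under positive scaling. -/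
def future : Set R21 := {x | ldot x x = 0 ∧ 0 < x 2}

/-- A nonempty connected set of future-pointing lightlike rays. -/
structure IsConicalInterval (U : Set R21) : Prop where
  subset_future : U ⊆ future
  smul_mem : ∀ x ∈ U, ∀ t : ℝ, 0 < t → t • x ∈ U
  isConnected : IsConnected U

/-- The closure relative to the set of future-pointing lightlike rays. -/
def clFuture (U : Set R21) : Set R21 := closure U ∩ future

/-- A conical interval that is closed in the set of future-pointing lightlike rays. -/
def IsClosedConicalInterval (U : Set R21) : Prop :=
  IsConicalInterval U ∧ clFuture U = U

/-- The closed conical interval swept out by going counterclockwise from the ray of `a` to the ray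
of `b` (for two distinct rays). -/
def arc (a b : R21) : Set R21 := {x ∈ future | 0 ≤ det3 a x b}

/-- The closed conical interval contained in the interval `I` and bounded by the rays of `a` and
`b`: of the two arcs with these endpoints, the one that is contained in `I`. -/
def intervalIn (I : Set R21) (a b : R21) : Set R21 :=
  {x | (arc a b ⊆ I ∧ x ∈ arc a b) ∨ (arc b a ⊆ I ∧ x ∈ arc b a)}

/-! ### Isometries and null frames -/

/-- Membership in `SO(2,1)⁰`: a linear isometry of the form preserving the orientation and the
time orientation. -/
structure IsSO21 (g : R21 ≃ₗ[ℝ] R21) : Prop where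
  isometry : ∀ x y, ldot (g x) (g y) = ldot x y
  det_eq_one : LinearMap.det (g : R21 →ₗ[ℝ] R21) = 1
  future : ∀ x ∈ future, g x ∈ future

/-- An element of `SO(2,1)⁰` with three distinct (real) eigenvalues. -/
def IsHyperbolic (g : R21 ≃ₗ[ℝ] R21) : Prop :=
  IsSO21 g ∧ ∃ a b c : ℝ, a ≠ b ∧ b ≠ c ∧ a ≠ c ∧
    Module.End.HasEigenvalue (g : Module.End ℝ R21) a ∧
    Module.End.HasEigenvalue (g : Module.End ℝ R21) b ∧
    Module.End.HasEigenvalue (g : Module.End ℝ R21) c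

/-- `(v, m, p)` is the null frame relative to the unit-spacelike vector `v`. -/
structure IsNullFrame (v m p : R21) : Prop where
  unit : ldot v v = 1
  minus_perp : ldot v m = 0
  plus_perp : ldot v p = 0
  minus_future : m ∈ future
  plus_future : p ∈ future
  minus_euclidean : m 0 ^ 2 + m 1 ^ 2 + m 2 ^ 2 = 1
  plus_euclidean : p 0 ^ 2 + p 1 ^ 2 + p 2 ^ 2 = 1
  orientation : 0 < det3 v m p

/-- `(v, m, p)` is the null frame `(x⁰_g, x⁻_g, x⁺_g)` of the isometry `g`. For hyperbolic `g` there
is exactly one. -/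
def IsFrameOf (g : R21 ≃ₗ[ℝ] R21) (v m p : R21) : Prop :=
  IsNullFrame v m p ∧ g v = v ∧ ∃ l : ℝ, 0 < l ∧ l < 1 ∧ g m = l • m ∧ g p = l⁻¹ • p

open Classical in
/-- The null frame of a hyperbolic isometry (and `0` for other maps). -/
def frame (g : R21 ≃ₗ[ℝ] R21) : R21 × R21 × R21 :=
  if h : ∃ f : R21 × R21 × R21, IsFrameOf g f.1 f.2.1 f.2.2 then h.choose else 0

/-- The neutral unit-spacelike eigenvector `x⁰_g`. -/
def xZero (g : R21 ≃ₗ[ℝ] R21) : R21 := (frame g).1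

/-- The repelling lightlike eigenvector `x⁻_g`. -/
def xMinus (g : R21 ≃ₗ[ℝ] R21) : R21 := (frame g).2.1

/-- The attracting lightlike eigenvector `x⁺_g`. -/
def xPlus (g : R21 ≃ₗ[ℝ] R21) : R21 := (frame g).2.2

/-- The Margulis invariant `⟨γ(p) - p, x⁰_g⟩` of an affine isometry `γ` with hyperbolic linear part
`g`. It does not depend on the point `p`, which is taken to be the origin. -/
def margulis (γ : R21 ≃ᵃ[ℝ] R21) : ℝ := ldot (γ 0 - 0) (xZero γ.linear)

/-- A group of affine transformations (with the discrete topology) acts properly: each compact set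
meets only finitely many of its translates. -/
def ActsProperly (Γ : Subgroup (R21 ≃ᵃ[ℝ] R21)) : Prop :=
  ∀ K : Set R21, IsCompact K → {γ : R21 ≃ᵃ[ℝ] R21 | γ ∈ Γ ∧ (γ '' K ∩ K).Nonempty}.Finite

/-! ### Transversal Schottky groups and Property C -/

/-- Four pairwise disjoint closed conical intervals form a Schottky system for the isometries
`g` and `h`. -/
structure IsSchottkySystem (g h : R21 ≃ₗ[ℝ] R21) (AgMinus AgPlus AhMinus AhPlus : Set R21) :
    Prop where
  left_mem : IsSO21 g
  right_mem : IsSO21 h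
  interval_gMinus : IsClosedConicalInterval AgMinus
  interval_gPlus : IsClosedConicalInterval AgPlus
  interval_hMinus : IsClosedConicalInterval AhMinus
  interval_hPlus : IsClosedConicalInterval AhPlus
  disjoint : [AgMinus, AgPlus, AhMinus, AhPlus].Pairwise Disjoint
  map_g : g '' AgMinus = clFuture (future \ AgPlus)
  map_h : h '' AhMinus = clFuture (future \ AhPlus)

/-- The Lorentz-perpendicular planes of `x⁰_g` and `x⁰_h` intersect in a timelike line. -/
def IsTransversal (g h : R21 ≃ₗ[ℝ] R21) : Prop :=
  ∃ t : R21, ldot t t < 0 ∧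
    {x : R21 | ldot x (xZero g) = 0 ∧ ldot x (xZero h) = 0} = (Submodule.span ℝ {t} : Set R21)

/-- Going counterclockwise, the rays come in the order `x⁻_g`, `x⁻_h`, `x⁺_g`. -/
def PosOrdered (g h : R21 ≃ₗ[ℝ] R21) : Prop :=
  0 < det3 (xMinus g) (xMinus h) (xPlus g)

/-- The cyclically reduced words of the form `g hⁱ g⁻¹ w` with `i > 0` if `e = true`, and of the form
`g h⁻ⁱ g⁻¹ w` with `i > 0` if `e = false`. The letters `(0, true)`, `(0, false)`, `(1, true)`,
`(1, false)` stand for `g`, `g⁻¹`, `h`, `h⁻¹`. -/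
def wordSet (e : Bool) : Set (FreeGroup (Fin 2)) :=
  {w | FreeGroup.IsCyclicallyReduced w.toWord ∧
    ∃ i : ℕ, 0 < i ∧ (((0, true) :: List.replicate i (1, e)) ++ [(0, false)]) <+: w.toWord}

/-- The isometry that a word in the two generators represents. -/
def eval (g h : R21 ≃ₗ[ℝ] R21) : FreeGroup (Fin 2) →* (R21 ≃ₗ[ℝ] R21) := FreeGroup.lift ![g, h]

/-- The affine isometry that a word in the two generators represents. -/
def evalAffine (γ η : R21 ≃ᵃ[ℝ] R21) : FreeGroup (Fin 2) →* (R21 ≃ᵃ[ℝ] R21) :=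
  FreeGroup.lift ![γ, η]

/-- The inequality of Property C, for generators with `PosOrdered g h`. -/
def PropertyCIneq (g h : R21 ≃ₗ[ℝ] R21) (AgPlus : Set R21) : Prop :=
  ∀ x ∈ intervalIn AgPlus (xPlus (g * h)) (g (xPlus h)),
    ∀ w₁ ∈ wordSet true, ∀ w₂ ∈ wordSet false,
      -ldot x (xZero (eval g h w₁)) < ldot x (xZero (eval g h w₂))

/-- Property C of a transversal Schottky pair: the inequality holds after `h` is replaced, if
necessary, by `h⁻¹` so that the eigenvectors are positively ordered. -/
def PropertyC (g h : R21 ≃ₗ[ℝ] R21) (AgPlus : Set R21) : Prop :=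
  (PosOrdered g h ∧ PropertyCIneq g h AgPlus) ∨ (PosOrdered g h⁻¹ ∧ PropertyCIneq g h⁻¹ AgPlus)

end FlatLorentz

end

/-!
For an isometry `w` with lightlike eigenvectors `m` (contracted) and `p` (expanded), the neutral
vector is `x⁰_w = axis m p`, and `⟨x, x⁰_w⟩` has the sign of `det [x m p]`. Signs of Margulis
invariants thus become statements about the cyclic order of rays (`PingPong.ldot_xZero_pos`), and
this order is read off from itineraries: if `p` and `x` lie in this order seen from the interval of
`s⁻¹`, then `s p` and `s x` do so seen from all rays outside the interval of `s`
(`PingPong.det3_map_pos`). Ping-pong also shows that nonempty cyclically reduced words are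
hyperbolic (`PingPong.exists_isAxisPair`).

The Margulis invariant of a cyclically reduced word is a sum over its letters
(`PingPong.wordMargulis_eq_sum`): if `v_g`, `v_h` are the translational parts, a letter `g` or `g⁻¹`
contributes `⟨v_g, x⁰_u⟩`, where `u` is the rotation of the word or of its inverse that begins with
this letter `g`; similarly for `h`. Let `n = k + 1`, let `a` and `b` be the attracting eigenvectors
of `g hᵏ g hᵏ⁺¹` and `g hᵏ⁺¹`, and first take `v_h = 0` and `v_g` on the segment between positive
multiples of `a` and `b`. For words of length at most `n` all contributions are positive except
possibly those with `u = g hⁱ g⁻¹ ⋯`, `i > 0`. Each of these is matched with one with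
`u = g h⁻ⁱ g⁻¹ ⋯`, since `g⁻¹` is the end of the same subword of the word or of its inverse
(`sum_typeSign`), and Property C says that the latter outweigh the former
(`exists_separating_constant`). So these words have a positive Margulis invariant, except that the
powers of `h` have invariant zero. On the other hand `g hᵏ⁺¹` has a negative one away from `b`, and
that of `W = g hᵏ⁺¹ g hᵏ` is negative at `a` and positive at `b`, hence zero at an intermediate
point.

Finally `v_h` is changed to a small positive multiple of `x⁰_h`, which makes the powers of `h`
positive, and `v_g` is adjusted so that the invariant of `W` remains zero
(`PingPong.exists_translations`). Then `W` acts with a fixed point although it has infinite order,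
so that the action is not proper (`not_actsProperly`).
-/

noncomputable section

namespace FlatLorentz

/-! ### The Lorentzian form and the determinant -/

theorem det3_eq (u v w : R21) : det3 u v w =
    u 0 * v 1 * w 2 - u 0 * v 2 * w 1 - u 1 * v 0 * w 2 + u 1 * v 2 * w 0 + u 2 * v 0 * w 1
      - u 2 * v 1 * w 0 := by
  simp [det3, Matrix.det_fin_three]

theorem ldot_comm (x y : R21) : ldot x y = ldot y x := by simp only [ldot]; ring

theorem ldot_add_left (x y z : R21) : ldot (x + y) z = ldot x z + ldot y z := by
  simp only [ldot, Pi.add_apply]; ring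

theorem ldot_smul_left (r : ℝ) (x z : R21) : ldot (r • x) z = r * ldot x z := by
  simp only [ldot, Pi.smul_apply, smul_eq_mul]; ring

theorem ldot_neg_left (x z : R21) : ldot (-x) z = -ldot x z := by
  simp only [ldot, Pi.neg_apply]; ring

theorem ldot_add_right (x y z : R21) : ldot z (x + y) = ldot z x + ldot z y := by
  simp only [ldot, Pi.add_apply]; ring

theorem ldot_smul_right (r : ℝ) (x z : R21) : ldot z (r • x) = r * ldot z x := by
  simp only [ldot, Pi.smul_apply, smul_eq_mul]; ring

theorem ldot_neg_right (x z : R21) : ldot z (-x) = -ldot z x := by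
  simp only [ldot, Pi.neg_apply]; ring

theorem eq_of_forall_ldot_eq {x y : R21} (h : ∀ z, ldot z x = ldot z y) : x = y := by
  have h0 := h ![1, 0, 0]
  have h1 := h ![0, 1, 0]
  have h2 := h ![0, 0, 1]
  simp [ldot] at h0 h1 h2
  ext i; fin_cases i <;> simp_all

theorem det3_rotate (x y z : R21) : det3 x y z = det3 y z x := by
  simp only [det3_eq]; ring

theorem det3_swap (x y z : R21) : det3 x y z = -det3 x z y := by
  simp only [det3_eq]; ring

theorem det3_smul_left (r : ℝ) (x y z : R21) : det3 (r • x) y z = r * det3 x y z := by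
  simp only [det3_eq, Pi.smul_apply, smul_eq_mul]; ring

theorem det3_smul_mid (r : ℝ) (x y z : R21) : det3 x (r • y) z = r * det3 x y z := by
  simp only [det3_eq, Pi.smul_apply, smul_eq_mul]; ring

theorem det3_smul_right (r : ℝ) (x y z : R21) : det3 x y (r • z) = r * det3 x y z := by
  simp only [det3_eq, Pi.smul_apply, smul_eq_mul]; ring

/-! ### The lightcone -/

theorem smul_mem_future {x : R21} (hx : x ∈ future) {t : ℝ} (ht : 0 < t) : t • x ∈ future := by
  refine ⟨?_, mul_pos ht hx.2⟩
  rw [ldot_smul_left, ldot_smul_right, hx.1]; ring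

/-- Two future-pointing lightlike vectors with vanishing product span the same ray. -/
theorem exists_smul_of_ldot_eq_zero {x y : R21} (hx : x ∈ future) (hy : y ∈ future)
    (h : ldot x y = 0) : ∃ r : ℝ, 0 < r ∧ y = r • x := by
  obtain ⟨hx0, hx2⟩ := hx
  obtain ⟨hy0, hy2⟩ := hy
  simp only [ldot] at *
  have e : (x 2 * y 0 - y 2 * x 0) ^ 2 + (x 2 * y 1 - y 2 * x 1) ^ 2 = 0 := by
    linear_combination (x 2) ^ 2 * hy0 + (y 2) ^ 2 * hx0 - 2 * x 2 * y 2 * h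
  have e0 : x 2 * y 0 - y 2 * x 0 = 0 := by
    nlinarith [sq_nonneg (x 2 * y 0 - y 2 * x 0), sq_nonneg (x 2 * y 1 - y 2 * x 1)]
  have e1 : x 2 * y 1 - y 2 * x 1 = 0 := by
    nlinarith [sq_nonneg (x 2 * y 0 - y 2 * x 0), sq_nonneg (x 2 * y 1 - y 2 * x 1)]
  refine ⟨y 2 / x 2, div_pos hy2 hx2, ?_⟩
  ext i; fin_cases i
  · simp only [Pi.smul_apply, smul_eq_mul, Fin.zero_eta]; field_simp; linarith
  · simp only [Pi.smul_apply, smul_eq_mul, Fin.mk_one]; field_simp; linarith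
  · simp only [Pi.smul_apply, smul_eq_mul, Fin.reduceFinMk]; field_simp

theorem ldot_nonpos {x y : R21} (hx : x ∈ future) (hy : y ∈ future) : ldot x y ≤ 0 := by
  obtain ⟨hx0, hx2⟩ := hx
  obtain ⟨hy0, hy2⟩ := hy
  simp only [ldot] at *
  have e : (x 2 * y 0 - y 2 * x 0) ^ 2 + (x 2 * y 1 - y 2 * x 1) ^ 2
      = -(2 * (x 2 * y 2)) * (x 0 * y 0 + x 1 * y 1 - x 2 * y 2) := by
    linear_combination (x 2) ^ 2 * hy0 + (y 2) ^ 2 * hx0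
  have : 0 < x 2 * y 2 := mul_pos hx2 hy2
  by_contra! hc
  nlinarith [mul_pos this hc, sq_nonneg (x 2 * y 0 - y 2 * x 0), sq_nonneg (x 2 * y 1 - y 2 * x 1)]

/-- The Gram determinant of three lightlike vectors. -/
theorem det3_sq {x y z : R21} (hx : ldot x x = 0) (hy : ldot y y = 0) (hz : ldot z z = 0) :
    det3 x y z ^ 2 = -2 * (ldot x y * ldot y z * ldot z x) := by
  have key : det3 x y z ^ 2 = -(ldot x x * ldot y y * ldot z z + 2 * (ldot x y * ldot y z * ldot z x)
      - ldot x x * ldot y z ^ 2 - ldot y y * ldot z x ^ 2 - ldot z z * ldot x y ^ 2) := by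
    simp only [det3_eq, ldot]; ring
  rw [key, hx, hy, hz]; ring

theorem det3_ne_zero {x y z : R21} (hx : x ∈ future) (hy : y ∈ future) (hz : z ∈ future)
    (hxy : ldot x y ≠ 0) (hyz : ldot y z ≠ 0) (hzx : ldot z x ≠ 0) : det3 x y z ≠ 0 := by
  intro h
  have := det3_sq hx.1 hy.1 hz.1
  rw [h] at this
  have h2 : ldot x y * ldot y z * ldot z x ≠ 0 := mul_ne_zero (mul_ne_zero hxy hyz) hzx
  exact h2 (by linarith)

/-- The linear relation between four vectors, paired with the lightlike vector `x`. This makes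
`y, z ↦ det3 x y z / (⟨x, y⟩ ⟨x, z⟩)` additive, so that the rays other than that of `x` are
linearly ordered. -/
theorem det3_relation {x : R21} (hx : ldot x x = 0) (y z t : R21) :
    det3 x y t * ldot x z = det3 x z t * ldot x y + det3 x y z * ldot x t := by
  have key : det3 y z t * ldot x x - det3 x z t * ldot x y + det3 x y t * ldot x z
      - det3 x y z * ldot x t = 0 := by
    simp only [det3_eq, ldot]; ring
  rw [hx] at key; linarith

theorem ldot_neg_of_det3_ne_zero {x y z : R21} (hx : x ∈ future) (hy : y ∈ future)
    (h : det3 x y z ≠ 0) : ldot x y < 0 := by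
  refine lt_of_le_of_ne (ldot_nonpos hx hy) fun h0 => h ?_
  obtain ⟨r, -, rfl⟩ := exists_smul_of_ldot_eq_zero hx hy h0
  rw [det3_smul_mid]; simp only [det3_eq]; ring

theorem det3_trans {x y z t : R21} (hx : x ∈ future) (hy : y ∈ future) (hz : z ∈ future)
    (ht : t ∈ future) (h1 : 0 < det3 x y z) (h2 : 0 < det3 x z t) : 0 < det3 x y t := by
  have r := det3_relation hx.1 y z t
  have hxy := ldot_neg_of_det3_ne_zero hx hy h1.ne'
  have hxz := ldot_neg_of_det3_ne_zero hx hz h2.ne'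
  have hxt := ldot_nonpos hx ht
  by_contra! hc
  nlinarith [mul_pos h2 (neg_pos.2 hxy), mul_nonneg h1.le (neg_nonneg.2 hxt),
    mul_nonneg (neg_nonneg.2 hc) (neg_nonneg.2 hxz.le)]

/-! ### Isometries -/

theorem IsSO21.det3_map {g : R21 ≃ₗ[ℝ] R21} (hg : IsSO21 g) (x y z : R21) :
    det3 (g x) (g y) (g z) = det3 x y z := by
  have h := (Pi.basisFun ℝ (Fin 3)).det_comp (g : R21 →ₗ[ℝ] R21) ![x, y, z]
  rw [hg.det_eq_one, one_mul] at h
  have e : ∀ v : Fin 3 → R21, (Pi.basisFun ℝ (Fin 3)).det v = det3 (v 0) (v 1) (v 2) := by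
    intro v
    rw [Pi.basisFun_det_apply, det3]
    congr 1
    ext i j
    fin_cases i <;> rfl
  rw [e, e] at h
  exact h

theorem IsSO21.mul {g h : R21 ≃ₗ[ℝ] R21} (hg : IsSO21 g) (hh : IsSO21 h) : IsSO21 (g * h) where
  isometry x y := by simp [hg.isometry, hh.isometry]
  det_eq_one := by
    have : ((g * h : R21 ≃ₗ[ℝ] R21) : R21 →ₗ[ℝ] R21)
      = (g : R21 →ₗ[ℝ] R21) ∘ₗ (h : R21 →ₗ[ℝ] R21) := rfl
    rw [this, LinearMap.det_comp, hg.det_eq_one, hh.det_eq_one, one_mul]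
  future x hx := hg.future _ (hh.future _ hx)

theorem IsSO21.one : IsSO21 1 where
  isometry _ _ := rfl
  det_eq_one := LinearMap.det_id
  future _ hx := hx

theorem IsSO21.inv {g : R21 ≃ₗ[ℝ] R21} (hg : IsSO21 g) : IsSO21 g⁻¹ where
  isometry x y := by
    rw [← hg.isometry, ← LinearEquiv.mul_apply, ← LinearEquiv.mul_apply, mul_inv_cancel]; rfl
  det_eq_one := by
    have h : LinearMap.det ((g * g⁻¹ : R21 ≃ₗ[ℝ] R21) : R21 →ₗ[ℝ] R21) = 1 := by
      rw [mul_inv_cancel]; exact LinearMap.det_id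
    have : ((g * g⁻¹ : R21 ≃ₗ[ℝ] R21) : R21 →ₗ[ℝ] R21)
      = (g : R21 →ₗ[ℝ] R21) ∘ₗ ((g⁻¹ : R21 ≃ₗ[ℝ] R21) : R21 →ₗ[ℝ] R21) := rfl
    rwa [this, LinearMap.det_comp, hg.det_eq_one, one_mul] at h
  future x hx := by
    have hgx : g (g⁻¹ x) = x := by rw [← LinearEquiv.mul_apply, mul_inv_cancel]; rfl
    have h0 : ldot (g⁻¹ x) (g⁻¹ x) = 0 := by rw [← hg.isometry, hgx, hx.1]
    refine ⟨h0, ?_⟩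
    rcases lt_trichotomy ((g⁻¹ x) 2) 0 with h | h | h
    · have : -(g⁻¹ x) ∈ FlatLorentz.future :=
        ⟨by rw [ldot_neg_left, ldot_neg_right, h0]; ring, by simpa using h⟩
      have := (hg.future _ this).2
      rw [map_neg, hgx, Pi.neg_apply] at this
      linarith [hx.2]
    · simp only [ldot, h] at h0
      have a0 : (g⁻¹ x) 0 = 0 := by nlinarith [sq_nonneg ((g⁻¹ x) 0), sq_nonneg ((g⁻¹ x) 1)]
      have a1 : (g⁻¹ x) 1 = 0 := by nlinarith [sq_nonneg ((g⁻¹ x) 0), sq_nonneg ((g⁻¹ x) 1)]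
      have : g⁻¹ x = 0 := by ext i; fin_cases i <;> assumption
      rw [this, map_zero] at hgx
      have := hx.2
      rw [← hgx] at this
      simp at this
    · exact h

theorem IsSO21.ldot_inv_left {g : R21 ≃ₗ[ℝ] R21} (hg : IsSO21 g) (x y : R21) :
    ldot (g x) y = ldot x (g⁻¹ y) := by
  rw [← hg.inv.isometry, ← LinearEquiv.mul_apply, inv_mul_cancel]; rfl

theorem continuous_ldot {X : Type*} [TopologicalSpace X] {f k : X → R21} (hf : Continuous f)
    (hk : Continuous k) : Continuous fun x => ldot (f x) (k x) := by
  unfold ldot; fun_prop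

theorem continuous_det3 {X : Type*} [TopologicalSpace X] {f k l : X → R21} (hf : Continuous f)
    (hk : Continuous k) (hl : Continuous l) : Continuous fun x => det3 (f x) (k x) (l x) := by
  simp only [det3_eq]; fun_prop

theorem continuous_linearEquiv (g : R21 ≃ₗ[ℝ] R21) : Continuous g :=
  LinearMap.continuous_of_finiteDimensional (g : R21 →ₗ[ℝ] R21)

/-! ### Null frames from pairs of lightlike eigenvectors -/

/-- The Lorentzian cross product, characterised by `⟨x, cross m p⟩ = det [x m p]`. -/
def cross (m p : R21) : R21 :=
  ![m 1 * p 2 - m 2 * p 1, m 2 * p 0 - m 0 * p 2, m 1 * p 0 - m 0 * p 1]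

/-- The unit spacelike vector perpendicular to the lightlike vectors `m` and `p` for which
`det [axis m p, m, p]` is positive. It only depends on the rays of `m` and `p`. -/
def axis (m p : R21) : R21 := (-ldot m p)⁻¹ • cross m p

theorem ldot_cross (x m p : R21) : ldot x (cross m p) = det3 x m p := by
  simp [ldot, det3_eq, cross]; ring

theorem ldot_axis (x m p : R21) : ldot x (axis m p) = (-ldot m p)⁻¹ * det3 x m p := by
  rw [axis, ldot_smul_right, ldot_cross]

theorem det3_cross {m : R21} (hm : ldot m m = 0) (p : R21) :
    det3 (cross m p) m p = ldot m p ^ 2 := by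
  have : det3 (cross m p) m p = ldot m p ^ 2 - ldot m m * ldot p p := by
    simp [det3_eq, cross, ldot]; ring
  rw [this, hm]; ring

/-- The decomposition of a vector in a null frame. -/
theorem sq_smul_eq {m p : R21} (hm : ldot m m = 0) (hp : ldot p p = 0) (v : R21) :
    ldot m p ^ 2 • v = det3 v m p • cross m p + (ldot m p * ldot v p) • m
      + (ldot m p * ldot v m) • p := by
  have key : (ldot m p ^ 2 - ldot m m * ldot p p) • v = det3 v m p • cross m p
      + (ldot m p * ldot v p - ldot p p * ldot v m) • m
      + (ldot m p * ldot v m - ldot m m * ldot v p) • p := by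
    ext i
    simp only [Pi.add_apply, Pi.smul_apply, smul_eq_mul, det3_eq, ldot]
    fin_cases i <;> simp [cross] <;> ring
  simpa [hm, hp] using key

theorem ldot_axis_self {m p : R21} (hm : m ∈ future) (h : ldot m p < 0) :
    ldot (axis m p) (axis m p) = 1 := by
  rw [ldot_axis, axis, det3_smul_left, det3_cross hm.1 p]
  have := h.ne
  field_simp

theorem det3_axis {m p : R21} (hm : m ∈ future) (h : ldot m p < 0) :
    det3 (axis m p) m p = -ldot m p := by
  rw [axis, det3_smul_left, det3_cross hm.1 p]
  have := h.ne
  field_simp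

theorem ldot_axis_left (m p : R21) : ldot (axis m p) m = 0 := by
  rw [ldot_comm, ldot_axis]; simp only [det3_eq]; ring

theorem ldot_axis_right (m p : R21) : ldot (axis m p) p = 0 := by
  rw [ldot_comm, ldot_axis]; simp only [det3_eq]; ring

/-- The conditions on the first vector of a null frame determine it. -/
theorem axis_unique {v m p : R21} (hm : m ∈ future) (hp : p ∈ future) (h : ldot m p < 0)
    (hvm : ldot v m = 0) (hvp : ldot v p = 0) (hv : ldot v v = 1) (ho : 0 < det3 v m p) :
    v = axis m p := by
  have e := sq_smul_eq hm.1 hp.1 v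
  rw [hvm, hvp, mul_zero, zero_smul, zero_smul, add_zero, add_zero] at e
  have e2 := congrArg (ldot v) e
  rw [ldot_smul_right, ldot_smul_right, ldot_cross, hv] at e2
  have e3 : det3 v m p = -ldot m p := by nlinarith
  rw [e3] at e
  have hne := h.ne
  have e4 : v = (ldot m p ^ 2)⁻¹ • (ldot m p ^ 2 • v) := by
    rw [smul_smul, inv_mul_cancel₀ (pow_ne_zero _ hne), one_smul]
  rw [e4, e, smul_smul, axis]
  congr 1
  field_simp

theorem axis_smul {r s : ℝ} (hr : 0 < r) (hs : 0 < s) (m p : R21) :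
    axis (r • m) (s • p) = axis m p := by
  have : cross (r • m) (s • p) = (r * s) • cross m p := by
    ext i; fin_cases i <;> simp [cross] <;> ring
  rw [axis, axis, this, smul_smul, ldot_smul_left, ldot_smul_right]
  congr 1
  rw [show -(r * (s * ldot m p)) = (r * s) * -ldot m p by ring, mul_inv]
  field_simp

theorem axis_swap (m p : R21) : axis p m = -axis m p := by
  have : cross p m = -cross m p := by
    ext i; fin_cases i <;> simp [cross] <;> ring
  rw [axis, axis, this, ldot_comm p m, smul_neg]

theorem IsSO21.map_axis {g : R21 ≃ₗ[ℝ] R21} (hg : IsSO21 g) (m p : R21) :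
    g (axis m p) = axis (g m) (g p) := by
  refine eq_of_forall_ldot_eq fun z => ?_
  rw [ldot_axis, ldot_comm, hg.ldot_inv_left, ldot_comm, ldot_axis, hg.isometry]
  have h : g (g⁻¹ z) = z := by rw [← LinearEquiv.mul_apply, mul_inv_cancel]; rfl
  conv_rhs => rw [← h, hg.det3_map]

theorem exists_euclidean_normalization {x : R21} (hx : x ∈ future) :
    ∃ r : ℝ, 0 < r ∧ (r • x) 0 ^ 2 + (r • x) 1 ^ 2 + (r • x) 2 ^ 2 = 1 := by
  have h : 0 < x 0 ^ 2 + x 1 ^ 2 + x 2 ^ 2 := by nlinarith [hx.2, sq_nonneg (x 0), sq_nonneg (x 1)]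
  refine ⟨(√(x 0 ^ 2 + x 1 ^ 2 + x 2 ^ 2))⁻¹, inv_pos.2 (Real.sqrt_pos.2 h), ?_⟩
  simp only [Pi.smul_apply, smul_eq_mul, mul_pow, inv_pow]
  rw [Real.sq_sqrt h.le]
  field_simp

/-- `m` and `p` are future-pointing lightlike eigenvectors of the isometry `w`, the first one
contracted and the second one expanded. -/
structure IsAxisPair (w : R21 ≃ₗ[ℝ] R21) (m p : R21) : Prop where
  isSO21 : IsSO21 w
  left_mem : m ∈ future
  right_mem : p ∈ future
  exists_eigenvalue : ∃ l : ℝ, 0 < l ∧ l < 1 ∧ w m = l • m ∧ w p = l⁻¹ • p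

namespace IsAxisPair

variable {w : R21 ≃ₗ[ℝ] R21} {m p : R21}

theorem ldot_neg (h : IsAxisPair w m p) : ldot m p < 0 := by
  obtain ⟨hw, hm, hp, l, l0, l1, em, ep⟩ := h
  refine lt_of_le_of_ne (ldot_nonpos hm hp) fun h0 => ?_
  obtain ⟨r, r0, rfl⟩ := exists_smul_of_ldot_eq_zero hm hp h0
  rw [map_smul, em] at ep
  have := congrFun ep 2
  simp only [Pi.smul_apply, smul_eq_mul] at this
  have hm2 := hm.2
  have h1 : l = l⁻¹ := by
    have h3 : r * m 2 ≠ 0 := (mul_pos r0 hm2).ne'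
    apply mul_right_cancel₀ h3; linarith
  have : 1 < l⁻¹ := (one_lt_inv₀ l0).2 l1
  linarith

theorem conj (h : IsAxisPair w m p) {c : R21 ≃ₗ[ℝ] R21} (hc : IsSO21 c) :
    IsAxisPair (c * w * c⁻¹) (c m) (c p) := by
  obtain ⟨hw, hm, hp, l, l0, l1, em, ep⟩ := h
  have h : ∀ z, c⁻¹ (c z) = z := fun z => by rw [← LinearEquiv.mul_apply, inv_mul_cancel]; rfl
  refine ⟨(hc.mul hw).mul hc.inv, hc.future _ hm, hc.future _ hp, l, l0, l1, ?_, ?_⟩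
  · simp [h, em]
  · simp [h, ep]

theorem inv (h : IsAxisPair w m p) : IsAxisPair w⁻¹ p m := by
  obtain ⟨hw, hm, hp, l, l0, l1, em, ep⟩ := h
  have h : ∀ z, w⁻¹ (w z) = z := fun z => by rw [← LinearEquiv.mul_apply, inv_mul_cancel]; rfl
  refine ⟨hw.inv, hp, hm, l, l0, l1, ?_, ?_⟩
  · have := h p
    rw [ep, map_smul] at this
    nth_rewrite 2 [← this]
    rw [smul_smul, mul_inv_cancel₀ l0.ne', one_smul]
  · have := h m
    rw [em, map_smul] at this
    nth_rewrite 2 [← this]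
    rw [smul_smul, inv_mul_cancel₀ l0.ne', one_smul]

theorem smul (h : IsAxisPair w m p) {r s : ℝ} (hr : 0 < r) (hs : 0 < s) :
    IsAxisPair w (r • m) (s • p) := by
  obtain ⟨hw, hm, hp, l, l0, l1, em, ep⟩ := h
  refine ⟨hw, smul_mem_future hm hr, smul_mem_future hp hs, l, l0, l1, ?_, ?_⟩
  · rw [map_smul, em, smul_comm]
  · rw [map_smul, ep, smul_comm]

theorem map_axis (h : IsAxisPair w m p) : w (axis m p) = axis m p := by
  obtain ⟨hw, hm, hp, l, l0, l1, em, ep⟩ := h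
  rw [hw.map_axis, em, ep, axis_smul l0 (inv_pos.2 l0)]

/-- The eigenvalues are those of `m`, of `axis m p` and of `p`. -/
theorem isHyperbolic (h : IsAxisPair w m p) : IsHyperbolic w := by
  have hmp := h.ldot_neg
  have ha := h.map_axis
  obtain ⟨hw, hm, hp, l, l0, l1, em, ep⟩ := h
  have hl : 1 < l⁻¹ := (one_lt_inv₀ l0).2 l1
  have key : ∀ (r : ℝ) (z : R21), z ≠ 0 → w z = r • z →
      Module.End.HasEigenvalue (w : Module.End ℝ R21) r := fun r z hz e =>
    Module.End.hasEigenvalue_of_hasEigenvector (Module.End.hasEigenvector_iff.2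
      ⟨Module.End.mem_eigenspace_iff.2 e, hz⟩)
  have hne : ∀ z ∈ future, z ≠ 0 := by
    rintro z hz rfl
    exact lt_irrefl _ hz.2
  refine ⟨hw, l, 1, l⁻¹, l1.ne, hl.ne, (l1.trans hl).ne, key _ _ (hne _ hm) em,
    key 1 (axis m p) ?_ (by rw [ha, one_smul]), key _ _ (hne _ hp) ep⟩
  intro h0
  have := ldot_axis_self hm hmp
  rw [h0] at this
  simp [ldot] at this

theorem isFrameOf (h : IsAxisPair w m p) (em : m 0 ^ 2 + m 1 ^ 2 + m 2 ^ 2 = 1)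
    (ep : p 0 ^ 2 + p 1 ^ 2 + p 2 ^ 2 = 1) : IsFrameOf w (axis m p) m p where
  left :=
    { unit := ldot_axis_self h.left_mem h.ldot_neg
      minus_perp := ldot_axis_left m p
      plus_perp := ldot_axis_right m p
      minus_future := h.left_mem
      plus_future := h.right_mem
      minus_euclidean := em
      plus_euclidean := ep
      orientation := by
        rw [det3_axis h.left_mem h.ldot_neg]; linarith [h.ldot_neg] }
  right := ⟨h.map_axis, h.exists_eigenvalue⟩

/-- The chosen null frame of `w` is determined by any pair of lightlike eigenvectors. -/
theorem frame_eq (h : IsAxisPair w m p) : xZero w = axis m p ∧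
    (∃ r : ℝ, 0 < r ∧ xMinus w = r • m) ∧ ∃ r : ℝ, 0 < r ∧ xPlus w = r • p := by
  obtain ⟨r, r0, er⟩ := exists_euclidean_normalization h.left_mem
  obtain ⟨s, s0, es⟩ := exists_euclidean_normalization h.right_mem
  have hex : ∃ f : R21 × R21 × R21, IsFrameOf w f.1 f.2.1 f.2.2 :=
    ⟨(_, _, _), (h.smul r0 s0).isFrameOf er es⟩
  have hf : IsFrameOf w (xZero w) (xMinus w) (xPlus w) := by
    have := hex.choose_spec
    simpa only [xZero, xMinus, xPlus, frame, dif_pos hex] using this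
  obtain ⟨hn, hv, k, k0, k1, em', ep'⟩ := hf
  have h' := h
  obtain ⟨hw, hm, hp, l, l0, l1, em, ep⟩ := h
  have hk : 1 < k⁻¹ := (one_lt_inv₀ k0).2 k1
  have hl : 1 < l⁻¹ := (one_lt_inv₀ l0).2 l1
  have hm0 : ldot m (xMinus w) = 0 := by
    have := hw.isometry m (xMinus w)
    rw [em, em', ldot_smul_left, ldot_smul_right] at this
    have h1 : l * k < 1 := by nlinarith
    have h2 : (1 - l * k) * ldot m (xMinus w) = 0 := by linarith
    rcases mul_eq_zero.1 h2 with h3 | h3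
    · linarith
    · exact h3
  have hp0 : ldot p (xPlus w) = 0 := by
    have := hw.isometry p (xPlus w)
    rw [ep, ep', ldot_smul_left, ldot_smul_right] at this
    have h1 : 1 < l⁻¹ * k⁻¹ := by nlinarith
    have h2 : (1 - l⁻¹ * k⁻¹) * ldot p (xPlus w) = 0 := by linarith
    rcases mul_eq_zero.1 h2 with h3 | h3
    · linarith
    · exact h3
  obtain ⟨r', r0', er'⟩ := exists_smul_of_ldot_eq_zero hm hn.minus_future hm0
  obtain ⟨s', s0', es'⟩ := exists_smul_of_ldot_eq_zero hp hn.plus_future hp0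
  refine ⟨?_, ⟨r', r0', er'⟩, ⟨s', s0', es'⟩⟩
  have hneg := (h'.smul r0' s0').ldot_neg
  rw [← er', ← es'] at hneg
  rw [axis_unique hn.minus_future hn.plus_future hneg hn.minus_perp hn.plus_perp hn.unit
    hn.orientation, er', es', axis_smul r0' s0']

end IsAxisPair

theorem xZero_conj {w c : R21 ≃ₗ[ℝ] R21} {m p : R21} (h : IsAxisPair w m p) (hc : IsSO21 c) :
    xZero (c * w * c⁻¹) = c (xZero w) := by
  rw [(h.conj hc).frame_eq.1, h.frame_eq.1, hc.map_axis]

theorem xZero_inv {w : R21 ≃ₗ[ℝ] R21} {m p : R21} (h : IsAxisPair w m p) :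
    xZero w⁻¹ = -xZero w := by
  rw [h.inv.frame_eq.1, h.frame_eq.1, axis_swap]

/-- An affine isometry with hyperbolic linear part and vanishing Margulis invariant has a fixed
point. -/
theorem exists_fixed_point {γ : R21 ≃ᵃ[ℝ] R21} {m p : R21} (h : IsAxisPair γ.linear m p)
    (h0 : margulis γ = 0) : ∃ y, γ y = y := by
  have hmp := h.ldot_neg.ne
  rw [margulis, h.frame_eq.1, ldot_axis, sub_zero] at h0
  have hd : det3 (γ 0) m p = 0 := by
    rcases mul_eq_zero.1 h0 with h1 | h1
    · exact absurd (neg_eq_zero.1 (inv_eq_zero.1 h1)) hmp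
    · exact h1
  have e := sq_smul_eq h.left_mem.1 h.right_mem.1 (γ 0)
  rw [hd, zero_smul, zero_add] at e
  obtain ⟨hw, hm, hp, l, l0, l1, em, ep⟩ := h
  have hl : 1 < l⁻¹ := (one_lt_inv₀ l0).2 l1
  have h1 : 1 - l ≠ 0 := by linarith
  have h2 : 1 - l⁻¹ ≠ 0 := by linarith
  set a := ldot m p
  have e' : γ 0 = (a⁻¹ * ldot (γ 0) p) • m + (a⁻¹ * ldot (γ 0) m) • p := by
    have : γ 0 = (a ^ 2)⁻¹ • (a ^ 2 • γ 0) := by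
      rw [smul_smul, inv_mul_cancel₀ (pow_ne_zero _ hmp), one_smul]
    rw [e, smul_add, smul_smul, smul_smul] at this
    convert this using 3 <;> field_simp
  set b := a⁻¹ * ldot (γ 0) p
  set c := a⁻¹ * ldot (γ 0) m
  refine ⟨(b / (1 - l)) • m + (c / (1 - l⁻¹)) • p, ?_⟩
  have hγ : ∀ z, γ z = γ.linear z + γ 0 := fun z => by
    have := γ.map_vadd 0 z
    simpa using this
  rw [hγ, e', map_add, map_smul, map_smul, em, ep, smul_smul, smul_smul]
  have hb : b / (1 - l) * l + b = b / (1 - l) := by field_simp; ring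
  have hc : c / (1 - l⁻¹) * l⁻¹ + c = c / (1 - l⁻¹) := by
    rw [div_mul_eq_mul_div, div_add' _ _ _ h2]; ring
  calc _ = (b / (1 - l) * l + b) • m + (c / (1 - l⁻¹) * l⁻¹ + c) • p := by module
    _ = _ := by rw [hb, hc]

/-- A group containing an affine isometry with a fixed point and hyperbolic linear part does not
act properly: the powers of the isometry are distinct and fix that point. -/
theorem not_actsProperly {Γ : Subgroup (R21 ≃ᵃ[ℝ] R21)} {γ : R21 ≃ᵃ[ℝ] R21} (hΓ : γ ∈ Γ)
    {m p : R21} (h : IsAxisPair γ.linear m p) (h0 : margulis γ = 0) : ¬ ActsProperly Γ := by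
  intro hp
  obtain ⟨y, hy⟩ := exists_fixed_point h h0
  obtain ⟨hw, hm, -, l, l0, l1, em, -⟩ := h
  have hfix : ∀ k : ℕ, (γ ^ k) y = y := fun k => by
    induction k with
    | zero => rfl
    | succ k ih => rw [pow_succ, AffineEquiv.mul_def, AffineEquiv.trans_apply, hy, ih]
  have hlin : ∀ k : ℕ, (γ ^ k).linear m = l ^ k • m := fun k => by
    induction k with
    | zero => simp; rfl
    | succ k ih =>
      have : (γ ^ (k + 1)).linear m = (γ ^ k).linear (γ.linear m) := by rw [pow_succ]; rfl
      rw [this, em, map_smul, ih, smul_smul, pow_succ, mul_comm]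
  have hinj : Function.Injective fun k : ℕ => γ ^ k := by
    intro i j hij
    have h1 := hlin i
    have h2 := hlin j
    simp only at hij
    rw [hij, h2] at h1
    have h3 := congrFun h1 2
    simp only [Pi.smul_apply, smul_eq_mul] at h3
    have h4 := mul_right_cancel₀ hm.2.ne' h3
    exact (pow_right_injective₀ l0 l1.ne h4).symm
  refine Set.infinite_of_injective_forall_mem hinj (fun k => ?_) (hp {y} isCompact_singleton)
  exact ⟨Γ.pow_mem hΓ k, y, ⟨y, rfl, hfix k⟩, rfl⟩

/-! ### Conical intervals -/

theorem clFuture_mem_of_tendsto {U : Set R21} (hU : clFuture U = U) {z : ℕ → R21} {x : R21}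
    (hz : ∀ k, z k ∈ U) (hx : x ∈ future) (h : Filter.Tendsto z Filter.atTop (nhds x)) : x ∈ U := by
  rw [← hU]
  exact ⟨mem_closure_of_tendsto h (Filter.Eventually.of_forall hz), hx⟩

namespace IsConicalInterval

variable {U : Set R21}

theorem ldot_neg (hU : IsConicalInterval U) {x y : R21} (hx : x ∈ U) (hy : y ∈ future)
    (h : y ∉ U) : ldot x y < 0 := by
  refine lt_of_le_of_ne (ldot_nonpos (hU.subset_future hx) hy) fun h0 => h ?_
  obtain ⟨r, r0, rfl⟩ := exists_smul_of_ldot_eq_zero (hU.subset_future hx) hy h0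
  exact hU.smul_mem x hx r r0

/-- The orientation of a triple does not change while one ray moves in an interval that avoids
the other two. -/
theorem det3_pos (hU : IsConicalInterval U) {y z x x' : R21} (hy : y ∈ future) (hz : z ∈ future)
    (hyU : y ∉ U) (hzU : z ∉ U) (hx : x ∈ U) (hx' : x' ∈ U) (h : 0 < det3 x y z) :
    0 < det3 x' y z := by
  by_contra! hc
  have hc' : ContinuousOn (fun u : R21 => det3 u y z) U :=
    (continuous_det3 continuous_id continuous_const continuous_const).continuousOn
  obtain ⟨u, hu, hu0⟩ := hU.isConnected.isPreconnected.intermediate_value hx' hx hc' ⟨hc, h.le⟩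
  have hyz : ldot y z ≠ 0 := by
    rw [det3_rotate] at h
    exact (ldot_neg_of_det3_ne_zero hy hz h.ne').ne
  refine det3_ne_zero (hU.subset_future hu) hy hz (hU.ldot_neg hu hy hyU).ne hyz ?_ hu0
  rw [ldot_comm]; exact (hU.ldot_neg hu hz hzU).ne

/-- An isometry mapping a closed interval of rays into itself fixes one of its rays. -/
theorem exists_fixed_ray (hU : IsConicalInterval U) (hcl : clFuture U = U) {d : R21}
    (hd : d ∈ future) (hdU : d ∉ U) {w : R21 ≃ₗ[ℝ] R21} (hw : ∀ x ∈ U, w x ∈ U) :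
    ∃ p ∈ U, ∃ r : ℝ, 0 < r ∧ w p = r • p := by
  obtain ⟨q, hq⟩ := hU.isConnected.nonempty
  -- The rays of `U` are represented by the compact set of points at height one.
  set K : Set R21 := {x | x ∈ U ∧ x 2 = 1} with hK
  have hnorm : ∀ x ∈ U, (x 2)⁻¹ • x ∈ K := fun x hx => by
    have := (hU.subset_future hx).2
    refine ⟨hU.smul_mem x hx _ (inv_pos.2 this), ?_⟩
    simp [this.ne']
  have hKe : K = closure U ∩ {x | ldot x x = 0 ∧ x 2 = 1} := by
    ext x
    constructor
    · rintro ⟨h1, h2⟩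
      exact ⟨subset_closure h1, (hU.subset_future h1).1, h2⟩
    · rintro ⟨h1, h2, h3⟩
      refine ⟨?_, h3⟩
      rw [← hcl]
      exact ⟨h1, h2, by rw [h3]; exact one_pos⟩
  have hKc : IsCompact K := by
    have hclosed : IsClosed K := by
      rw [hKe]
      refine isClosed_closure.inter (IsClosed.inter ?_ ?_)
      · exact isClosed_eq (continuous_ldot continuous_id continuous_id) continuous_const
      · exact isClosed_eq (continuous_apply 2) continuous_const
    refine Metric.isCompact_of_isClosed_isBounded hclosed
      ((Metric.isBounded_closedBall (x := (0 : R21)) (r := 1)).subset ?_)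
    rintro x ⟨h1, h2⟩
    have h3 := (hU.subset_future h1).1
    simp only [ldot, h2] at h3
    rw [mem_closedBall_zero_iff, pi_norm_le_iff_of_nonneg zero_le_one]
    intro i
    rw [Real.norm_eq_abs, ← sq_le_one_iff_abs_le_one]
    fin_cases i
    · show x 0 ^ 2 ≤ 1
      nlinarith [sq_nonneg (x 1)]
    · show x 1 ^ 2 ≤ 1
      nlinarith [sq_nonneg (x 0)]
    · show x 2 ^ 2 ≤ 1
      rw [h2]; norm_num
  have hdx : ∀ x ∈ U, ldot d x < 0 := fun x hx => by
    rw [ldot_comm]; exact hU.ldot_neg hx hd hdU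
  set τ : R21 → ℝ := fun x => det3 d q x / ldot d x with hτ
  have hτc : ContinuousOn τ K := by
    refine ContinuousOn.div ?_ ?_ fun x hx => (hdx x hx.1).ne
    · exact (continuous_det3 continuous_const continuous_const continuous_id).continuousOn
    · exact (continuous_ldot continuous_const continuous_id).continuousOn
  have hdiff : ∀ x ∈ U, ∀ y ∈ U, τ y ≤ τ x → 0 ≤ det3 d x y := fun x hx y hy hxy => by
    have r := det3_relation hd.1 q x y
    have hx' := hdx x hx
    have hy' := hdx y hy
    simp only [hτ] at hxy
    rw [div_le_iff_of_neg hy', div_mul_eq_mul_div, div_le_iff_of_neg hx'] at hxy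
    have : 0 ≤ det3 d x y * -ldot d q := by linarith
    exact nonneg_of_mul_nonneg_left this (neg_pos.2 (hdx q hq))
  have hτs : ∀ x ∈ U, τ ((x 2)⁻¹ • x) = τ x := fun x hx => by
    have h2 := (inv_pos.2 (hU.subset_future hx).2).ne'
    simp only [hτ, det3_smul_right, ldot_smul_right]
    exact mul_div_mul_left _ _ h2
  have hKne : K.Nonempty := ⟨_, hnorm q hq⟩
  obtain ⟨a, ha, hamax⟩ := hKc.exists_isMaxOn hKne hτc
  obtain ⟨b, hb, hbmin⟩ := hKc.exists_isMinOn hKne hτc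
  have hfa : 0 ≤ det3 d a (w a) := hdiff a ha.1 _ (hw a ha.1) (by
    rw [← hτs _ (hw a ha.1)]; exact hamax (hnorm _ (hw a ha.1)))
  have hfb : det3 d b (w b) ≤ 0 := by
    have := hdiff (w b) (hw b hb.1) b hb.1 (by
      rw [← hτs _ (hw b hb.1)]; exact hbmin (hnorm _ (hw b hb.1)))
    rw [det3_swap]; linarith
  have hc' : ContinuousOn (fun u : R21 => det3 d u (w u)) U :=
    (continuous_det3 continuous_const continuous_id (continuous_linearEquiv w)).continuousOn
  obtain ⟨p, hp, hp0⟩ := hU.isConnected.isPreconnected.intermediate_value hb.1 ha.1 hc' ⟨hfb, hfa⟩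
  refine ⟨p, hp, ?_⟩
  have hpf := hU.subset_future hp
  have hwf := hU.subset_future (hw p hp)
  apply exists_smul_of_ldot_eq_zero hpf hwf
  by_contra hne
  refine det3_ne_zero hd hpf hwf (hdx p hp).ne hne ?_ hp0
  rw [ldot_comm]; exact (hdx _ (hw p hp)).ne

end IsConicalInterval

/-! ### Words -/

/-- The letters: `(0, true)`, `(0, false)`, `(1, true)`, `(1, false)` stand for `g`, `g⁻¹`, `h`,
`h⁻¹`. -/
abbrev Letter : Type := Fin 2 × Bool

/-- The inverse of a letter. -/
def bar (s : Letter) : Letter := (s.1, !s.2)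

@[simp] theorem bar_bar (s : Letter) : bar (bar s) = s := by simp [bar]

theorem bar_ne (s : Letter) : bar s ≠ s := by
  revert s; decide

theorem bar_mk (i : Fin 2) (b : Bool) : bar (i, b) = (i, !b) := rfl

theorem letter_rel_iff (s t : Letter) : (s.1 = t.1 → s.2 = t.2) ↔ t ≠ bar s := by
  revert s t; decide

open FreeGroup in
/-- A form of cyclic reducedness that is evidently stable under rotation and inversion. -/
theorem isCyclicallyReduced_iff_append_self (L : List Letter) :
    IsCyclicallyReduced L ↔ IsReduced (L ++ L) := by
  rw [isCyclicallyReduced_iff, FreeGroup.IsReduced, FreeGroup.IsReduced, List.isChain_append]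
  tauto

open FreeGroup in
theorem isCyclicallyReduced_append_comm {L M : List Letter} (h : IsCyclicallyReduced (L ++ M)) :
    IsCyclicallyReduced (M ++ L) := by
  have h3 := (h.flatten_replicate 3).isReduced
  rw [isCyclicallyReduced_iff_append_self]
  exact h3.infix ⟨L, M, by simp [List.replicate]⟩

open FreeGroup in
theorem isReduced_invRev {L : List Letter} (h : IsReduced L) : IsReduced (invRev L) := by
  rw [isReduced_iff_reduce_eq] at *
  rw [reduce_invRev, h]

open FreeGroup in
theorem isCyclicallyReduced_invRev {L : List Letter} (h : IsCyclicallyReduced L) :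
    IsCyclicallyReduced (invRev L) := by
  rw [isCyclicallyReduced_iff_append_self] at *
  have := isReduced_invRev h
  rwa [invRev_append] at this

theorem invRev_cons (a : Letter) (L : List Letter) :
    FreeGroup.invRev (a :: L) = FreeGroup.invRev L ++ [bar a] := by
  simp [FreeGroup.invRev, bar]

theorem invRev_concat (a : Letter) (L : List Letter) :
    FreeGroup.invRev (L ++ [a]) = bar a :: FreeGroup.invRev L := by
  simp [FreeGroup.invRev, bar]

/-- The isometry represented by a list of letters. -/
def wordMap (g h : R21 ≃ₗ[ℝ] R21) (L : List Letter) : R21 ≃ₗ[ℝ] R21 := eval g h (FreeGroup.mk L)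

section wordMap
variable (g h : R21 ≃ₗ[ℝ] R21)

theorem wordMap_append (L M : List Letter) :
    wordMap g h (L ++ M) = wordMap g h L * wordMap g h M := by
  rw [wordMap, ← FreeGroup.mul_mk, map_mul]; rfl

theorem wordMap_cons (s : Letter) (L : List Letter) :
    wordMap g h (s :: L) = wordMap g h [s] * wordMap g h L := wordMap_append g h [s] L

theorem wordMap_invRev (L : List Letter) :
    wordMap g h (FreeGroup.invRev L) = (wordMap g h L)⁻¹ := by
  rw [wordMap, ← FreeGroup.inv_mk, map_inv]; rfl

theorem wordMap_bar (s : Letter) : wordMap g h [bar s] = (wordMap g h [s])⁻¹ :=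
  wordMap_invRev g h [s]

theorem wordMap_append_apply (L M : List Letter) (x : R21) :
    wordMap g h (L ++ M) x = wordMap g h L (wordMap g h M x) := by
  rw [wordMap_append]; rfl

theorem wordMap_cons_apply (s : Letter) (L : List Letter) (x : R21) :
    wordMap g h (s :: L) x = wordMap g h [s] (wordMap g h L x) := by
  rw [wordMap_cons]; rfl

theorem wordMap_nil_apply (x : R21) : wordMap g h [] x = x := by
  simp [wordMap, ← FreeGroup.one_eq_mk]

end wordMap

/-! ### Ping-pong -/

/-- A Schottky system, with the four intervals indexed by the letters. -/
structure PingPong (g h : R21 ≃ₗ[ℝ] R21) (A : Letter → Set R21) : Prop where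
  isSO21_letter : ∀ s, IsSO21 (wordMap g h [s])
  interval : ∀ s, IsConicalInterval (A s)
  closed : ∀ s, clFuture (A s) = A s
  disj : ∀ s t, s ≠ t → ∀ x ∈ A s, x ∉ A t
  maps : ∀ s, ∀ x ∈ future, x ∉ A (bar s) → wordMap g h [s] x ∈ A s

namespace PingPong

variable {g h : R21 ≃ₗ[ℝ] R21} {A : Letter → Set R21}

theorem isSO21 (P : PingPong g h A) (L : List Letter) : IsSO21 (wordMap g h L) := by
  induction L with
  | nil => exact IsSO21.one
  | cons s L ih => rw [wordMap_cons]; exact (P.isSO21_letter s).mul ih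

theorem mem_future (P : PingPong g h A) {s : Letter} {x : R21} (hx : x ∈ A s) : x ∈ future :=
  (P.interval s).subset_future hx

theorem wordMap_mem (P : PingPong g h A) (L : List Letter) : ∀ (s t : Letter),
    FreeGroup.IsReduced (s :: L ++ [t]) → ∀ x ∈ A t, wordMap g h (s :: L) x ∈ A s := by
  induction L with
  | nil =>
    intro s t hr x hx
    refine P.maps s x (P.mem_future hx) (P.disj _ _ ?_ x hx)
    rw [← letter_rel_iff]
    simpa [FreeGroup.IsReduced] using hr
  | cons a L ih =>
    intro s t hr x hx
    rw [List.cons_append, List.cons_append, FreeGroup.isReduced_cons_cons] at hr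
    have hm := ih a t hr.2 x hx
    rw [wordMap_cons_apply]
    refine P.maps s _ (P.mem_future hm) (P.disj _ _ ?_ _ hm)
    rw [← letter_rel_iff]
    exact hr.1

theorem wordMap_mem_of_cyclic (P : PingPong g h A) {L : List Letter} {s : Letter}
    (hr : FreeGroup.IsCyclicallyReduced (s :: L)) {x : R21} (hx : x ∈ A s) :
    wordMap g h (s :: L) x ∈ A s := by
  refine P.wordMap_mem L s s ?_ x hx
  rw [isCyclicallyReduced_iff_append_self] at hr
  exact hr.infix ⟨[], L, by simp⟩

/-- The map given by a word beginning with `a` and ending with `b` does not dilate its fixed ray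
in `A a` by a factor `r ≤ 1`: otherwise the rays of a third interval, which the powers of the map
send to `A a`, would converge to the other fixed ray, or not move at all. -/
theorem one_lt_of_fixed (P : PingPong g h A) {w : R21 ≃ₗ[ℝ] R21} (hw : IsSO21 w) {a b : Letter}
    (hab : a ≠ b) (ha : ∀ t, t ≠ b → ∀ x ∈ A t, w x ∈ A a) {m p : R21}
    (hm : m ∈ A b) (hp : p ∈ A a) {r : ℝ} (hr : 0 < r) (ep : w p = r • p) (em : w m = r⁻¹ • m) :
    1 < r := by
  by_contra! hc
  have hmf := P.mem_future hm
  have hpf := P.mem_future hp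
  have hmp : ldot m p < 0 := (P.interval b).ldot_neg hm hpf (P.disj _ _ hab p hp)
  obtain ⟨t, hta, htb⟩ : ∃ t : Letter, t ≠ a ∧ t ≠ b :=
    (by decide : ∀ a b : Letter, ∃ t : Letter, t ≠ a ∧ t ≠ b) a b
  obtain ⟨y, hy⟩ := (P.interval t).isConnected.nonempty
  have hyf := P.mem_future hy
  have hya : y ∉ A a := P.disj _ _ hta y hy
  have hyp : ldot y p < 0 := by
    rw [ldot_comm]; exact (P.interval a).ldot_neg hp hyf hya
  have hcr : w (cross m p) = cross m p := by
    have h1 := hw.map_axis m p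
    rw [em, ep, axis_smul (inv_pos.2 hr) hr, axis, map_smul] at h1
    exact smul_right_injective _ (inv_ne_zero (neg_ne_zero.2 hmp.ne)) h1
  have e := sq_smul_eq hmf.1 hpf.1 y
  have hpow : ∀ k : ℕ, ∃ z ∈ (if k = 0 then A t else A a), ldot m p ^ 2 • z =
      det3 y m p • cross m p + (ldot m p * ldot y p * (r⁻¹) ^ k) • m
        + (ldot m p * ldot y m * r ^ k) • p := by
    intro k
    induction k with
    | zero => exact ⟨y, by simpa using hy, by simpa using e⟩
    | succ k ih =>
      obtain ⟨z, hz, ez⟩ := ih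
      refine ⟨w z, ?_, ?_⟩
      · simp only [Nat.succ_ne_zero, if_false]
        split_ifs at hz
        · exact ha t htb z hz
        · exact ha a hab z hz
      · rw [← map_smul, ez, map_add, map_add, map_smul, map_smul, map_smul, hcr, em, ep, smul_smul,
          smul_smul, pow_succ, pow_succ, mul_assoc, mul_assoc, mul_assoc, mul_assoc]
  rcases hc.lt_or_eq with hc | rfl
  · choose z hz ez using fun k : ℕ => hpow (k + 1)
    simp only [Nat.succ_ne_zero, if_false] at hz
    set u : ℕ → R21 := fun k => r ^ (k + 1) • (ldot m p ^ 2 • z k) with hu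
    have hua : ∀ k, u k ∈ A a := fun k =>
      (P.interval a).smul_mem _ ((P.interval a).smul_mem _ (hz k) _ (by
        have := hmp.ne; positivity)) _ (pow_pos hr _)
    have hr0 : Filter.Tendsto (fun k : ℕ => r ^ (k + 1)) Filter.atTop (nhds 0) :=
      (tendsto_pow_atTop_nhds_zero_of_lt_one hr.le hc).comp (Filter.tendsto_add_atTop_nat 1)
    have hue : u = fun k => (r ^ (k + 1) * det3 y m p) • cross m p + (ldot m p * ldot y p) • m
        + (r ^ (k + 1) * (ldot m p * ldot y m * r ^ (k + 1))) • p := by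
      funext k
      have hrk : r ^ (k + 1) * r⁻¹ ^ (k + 1) = 1 := by
        rw [← mul_pow, mul_inv_cancel₀ hr.ne', one_pow]
      simp only [hu]
      rw [ez k, smul_add, smul_add, smul_smul, smul_smul, smul_smul]
      rw [show r ^ (k + 1) * (ldot m p * ldot y p * r⁻¹ ^ (k + 1))
        = ldot m p * ldot y p * (r ^ (k + 1) * r⁻¹ ^ (k + 1)) by ring, hrk, mul_one]
    have hlim : Filter.Tendsto u Filter.atTop (nhds ((ldot m p * ldot y p) • m)) := by
      rw [hue]
      have h1 := (hr0.mul_const (det3 y m p)).smul_const (cross m p)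
      have h2 := (hr0.mul (hr0.const_mul (ldot m p * ldot y m))).smul_const p
      have h3 := (h1.add_const ((ldot m p * ldot y p) • m)).add h2
      simpa using h3
    have hpos : 0 < ldot m p * ldot y p := mul_pos_of_neg_of_neg hmp hyp
    exact P.disj _ _ hab.symm _ ((P.interval b).smul_mem _ hm _ hpos)
      (clFuture_mem_of_tendsto (P.closed a) hua (smul_mem_future hmf hpos) hlim)
  · obtain ⟨z, hz, ez⟩ := hpow 1
    simp only [one_ne_zero, if_false] at hz
    have : ldot m p ^ 2 • z = ldot m p ^ 2 • y := by rw [ez, e]; simp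
    have := smul_right_injective _ (pow_ne_zero 2 hmp.ne) this
    exact hya (this ▸ hz)

/-- A nonempty cyclically reduced word represents a hyperbolic isometry, whose attracting ray lies
in the interval of its first letter and whose repelling ray lies in the interval of the inverse of
its last letter. -/
theorem exists_isAxisPair (P : PingPong g h A) {L : List Letter} {a : Letter}
    (hr : FreeGroup.IsCyclicallyReduced (a :: L)) :
    ∃ b, b ≠ a ∧ ∃ m ∈ A b, ∃ p ∈ A a, IsAxisPair (wordMap g h (a :: L)) m p := by
  obtain ⟨M, c, hM⟩ : ∃ (M : List Letter) (c : Letter), a :: L = M ++ [c] :=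
    ⟨_, _, (List.dropLast_append_getLast (List.cons_ne_nil a L)).symm⟩
  have hinv : FreeGroup.invRev (a :: L) = bar c :: FreeGroup.invRev M := by
    rw [hM, invRev_concat]
  have hr' := isCyclicallyReduced_invRev hr
  rw [hinv] at hr'
  have hred : FreeGroup.IsReduced (M ++ [c] ++ [a]) := by
    rw [← hM]
    exact ((isCyclicallyReduced_iff_append_self _).1 hr).infix ⟨[], L, by simp⟩
  have hca : bar c ≠ a := by
    have := hred.infix (L₁ := [c, a]) ⟨M, [], by simp⟩
    rw [FreeGroup.isReduced_cons_cons, letter_rel_iff] at this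
    exact this.1.symm
  have hw := P.isSO21 (a :: L)
  set w := wordMap g h (a :: L) with hwd
  obtain ⟨d, hd⟩ := (P.interval (bar a)).isConnected.nonempty
  obtain ⟨p, hp, r, r0, ep⟩ := (P.interval a).exists_fixed_ray (P.closed a) (P.mem_future hd)
    (P.disj _ _ (bar_ne a) d hd) (w := w) fun x hx => P.wordMap_mem_of_cyclic hr hx
  obtain ⟨d', hd'⟩ := (P.interval c).isConnected.nonempty
  obtain ⟨m, hm, s, s0, em⟩ := (P.interval (bar c)).exists_fixed_ray (P.closed (bar c))
    (P.mem_future hd') (P.disj _ _ (bar_ne c).symm d' hd')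
    (w := wordMap g h (bar c :: FreeGroup.invRev M)) fun x hx => P.wordMap_mem_of_cyclic hr' hx
  rw [← hinv, wordMap_invRev] at em
  have hwinv : ∀ z, w (w⁻¹ z) = z := fun z => by
    rw [← LinearEquiv.mul_apply, mul_inv_cancel]; rfl
  have em' : w m = s⁻¹ • m := by
    have h1 := hwinv m
    rw [em, map_smul] at h1
    nth_rewrite 2 [← h1]
    rw [smul_smul, inv_mul_cancel₀ s0.ne', one_smul]
  have hmp : ldot m p < 0 := (P.interval _).ldot_neg hm (P.mem_future hp) (P.disj _ _ hca.symm p hp)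
  have hsr : s = r := by
    have h1 := hw.isometry m p
    rw [em', ep, ldot_smul_left, ldot_smul_right, ← mul_assoc] at h1
    have h2 : s⁻¹ * r = 1 := mul_right_cancel₀ hmp.ne (by rw [h1, one_mul])
    field_simp at h2
    exact h2.symm
  rw [hsr] at em'
  have h1r : 1 < r := by
    refine P.one_lt_of_fixed hw hca.symm ?_ hm hp r0 ep em'
    intro t ht x hx
    refine P.wordMap_mem L a t ?_ x hx
    rw [hM]
    refine List.isChain_append.2 ⟨hred.infix ⟨[], [a], by simp⟩, List.isChain_singleton _, ?_⟩
    intro u hu v hv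
    simp only [List.getLast?_concat, Option.mem_def, Option.some.injEq, List.head?_cons] at hu hv
    subst hu hv
    exact (letter_rel_iff _ _).2 ht
  refine ⟨bar c, hca, m, hm, p, hp, hw, P.mem_future hm, P.mem_future hp, r⁻¹, inv_pos.2 r0,
    inv_lt_one_of_one_lt₀ h1r, em', ?_⟩
  rw [inv_inv, ep]

end PingPong

/-! ### Schottky systems as ping-pong data -/

theorem wordMap_g (g h : R21 ≃ₗ[ℝ] R21) : wordMap g h [(0, true)] = g := by
  simp [wordMap, eval]

theorem wordMap_h (g h : R21 ≃ₗ[ℝ] R21) : wordMap g h [(1, true)] = h := by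
  simp [wordMap, eval]

theorem wordMap_g_inv (g h : R21 ≃ₗ[ℝ] R21) : wordMap g h [(0, false)] = g⁻¹ := by
  simp [wordMap, eval]

theorem wordMap_h_inv (g h : R21 ≃ₗ[ℝ] R21) : wordMap g h [(1, false)] = h⁻¹ := by
  simp [wordMap, eval]

/-- The intervals of a Schottky system, indexed by the letters: the interval of a letter contains
its attracting ray. -/
def letterInterval (AgMinus AgPlus AhMinus AhPlus : Set R21) : Letter → Set R21
  | (0, true) => AgPlus
  | (0, false) => AgMinus
  | (1, true) => AhPlus
  | (1, false) => AhMinus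

/-- The defining equality of a Schottky interval pair, as a ping-pong rule. -/
theorem map_mem_of_image_eq {g : R21 ≃ₗ[ℝ] R21} (hg : IsSO21 g) {U V : Set R21}
    (h : g '' U = clFuture (future \ V)) {x : R21} (hx : x ∈ future) (hU : x ∉ U) : g x ∈ V := by
  by_contra hV
  have hm : g x ∈ clFuture (future \ V) :=
    ⟨subset_closure ⟨hg.future x hx, hV⟩, hg.future x hx⟩
  rw [← h] at hm
  obtain ⟨y, hy, e⟩ := hm
  exact hU (g.injective e ▸ hy)

theorem inv_map_mem_of_image_eq {g : R21 ≃ₗ[ℝ] R21} {U V : Set R21}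
    (h : g '' U = clFuture (future \ V)) {x : R21} (hx : x ∈ future) (hV : x ∉ V) :
    g⁻¹ x ∈ U := by
  have hm : x ∈ clFuture (future \ V) := ⟨subset_closure ⟨hx, hV⟩, hx⟩
  rw [← h] at hm
  obtain ⟨y, hy, rfl⟩ := hm
  have : g⁻¹ (g y) = y := by rw [← LinearEquiv.mul_apply, inv_mul_cancel]; rfl
  rwa [this]

theorem IsSchottkySystem.pingPong {g h : R21 ≃ₗ[ℝ] R21} {AgMinus AgPlus AhMinus AhPlus : Set R21}
    (hS : IsSchottkySystem g h AgMinus AgPlus AhMinus AhPlus) :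
    PingPong g h (letterInterval AgMinus AgPlus AhMinus AhPlus) := by
  have hd := hS.disjoint
  simp only [List.pairwise_cons, List.mem_cons, List.not_mem_nil, or_false, forall_eq_or_imp,
    forall_eq, List.Pairwise.nil, and_true, Set.disjoint_left] at hd
  have hgI := hS.left_mem
  have hhI := hS.right_mem
  refine ⟨?_, ?_, ?_, ?_, ?_⟩
  · rintro ⟨i, b⟩
    fin_cases i <;> cases b
    · exact wordMap_g_inv g h ▸ hgI.inv
    · exact (wordMap_g g h).symm ▸ hgI
    · exact wordMap_h_inv g h ▸ hhI.inv
    · exact (wordMap_h g h).symm ▸ hhI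
  · rintro ⟨i, b⟩
    fin_cases i <;> cases b
    exacts [hS.interval_gMinus.1, hS.interval_gPlus.1, hS.interval_hMinus.1, hS.interval_hPlus.1]
  · rintro ⟨i, b⟩
    fin_cases i <;> cases b
    exacts [hS.interval_gMinus.2, hS.interval_gPlus.2, hS.interval_hMinus.2, hS.interval_hPlus.2]
  · rintro ⟨i, b⟩ ⟨j, c⟩ hne x hx hx'
    fin_cases i <;> cases b <;> fin_cases j <;> cases c <;>
      simp [letterInterval] at hne hx hx' <;> grind
  · rintro ⟨i, b⟩ x hx hxA
    fin_cases i <;> cases b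
    · exact (wordMap_g_inv g h).symm ▸ inv_map_mem_of_image_eq hS.map_g hx hxA
    · exact (wordMap_g g h).symm ▸ map_mem_of_image_eq hgI hS.map_g hx hxA
    · exact (wordMap_h_inv g h).symm ▸ inv_map_mem_of_image_eq hS.map_h hx hxA
    · exact (wordMap_h g h).symm ▸ map_mem_of_image_eq hhI hS.map_h hx hxA

/-- The involution of the letters that exchanges `h` and `h⁻¹`. -/
def swapH (s : Letter) : Letter := if s.1 = 1 then bar s else s

theorem wordMap_swapH (g h : R21 ≃ₗ[ℝ] R21) (s : Letter) :
    wordMap g h⁻¹ [s] = wordMap g h [swapH s] := by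
  obtain ⟨i, b⟩ := s
  fin_cases i <;> cases b <;> simp [swapH, bar, wordMap, eval]

theorem PingPong.swapH {g h : R21 ≃ₗ[ℝ] R21} {A : Letter → Set R21} (P : PingPong g h A) :
    PingPong g h⁻¹ (fun s => A (swapH s)) where
  isSO21_letter s := by rw [wordMap_swapH]; exact P.isSO21_letter _
  interval s := P.interval _
  closed s := P.closed _
  disj s t hst := P.disj _ _ ((by decide : ∀ s t, s ≠ t → FlatLorentz.swapH s ≠
    FlatLorentz.swapH t) s t hst)
  maps s x hx hA := by
    rw [wordMap_swapH]
    refine P.maps _ x hx ?_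
    rwa [(by decide : ∀ s, FlatLorentz.swapH (bar s) = bar (FlatLorentz.swapH s)) s] at hA

namespace PingPong

variable {g h : R21 ≃ₗ[ℝ] R21} {A : Letter → Set R21}

theorem isAxisPair (P : PingPong g h A) {L : List Letter} {a : Letter}
    (hr : FreeGroup.IsCyclicallyReduced (a :: L)) :
    IsAxisPair (wordMap g h (a :: L)) (xMinus (wordMap g h (a :: L)))
      (xPlus (wordMap g h (a :: L))) := by
  obtain ⟨b, hb, m, hm, p, hp, hax⟩ := P.exists_isAxisPair hr
  obtain ⟨-, ⟨r, r0, er⟩, ⟨s, s0, es⟩⟩ := hax.frame_eq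
  rw [er, es]
  exact hax.smul r0 s0

theorem xPlus_mem (P : PingPong g h A) {L : List Letter} {a : Letter}
    (hr : FreeGroup.IsCyclicallyReduced (a :: L)) : xPlus (wordMap g h (a :: L)) ∈ A a := by
  obtain ⟨b, hb, m, hm, p, hp, hax⟩ := P.exists_isAxisPair hr
  obtain ⟨-, -, ⟨s, s0, es⟩⟩ := hax.frame_eq
  rw [es]
  exact (P.interval a).smul_mem _ hp s s0

theorem exists_xMinus_mem (P : PingPong g h A) {L : List Letter} {a : Letter}
    (hr : FreeGroup.IsCyclicallyReduced (a :: L)) :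
    ∃ b, b ≠ a ∧ xMinus (wordMap g h (a :: L)) ∈ A b := by
  obtain ⟨b, hb, m, hm, p, hp, hax⟩ := P.exists_isAxisPair hr
  obtain ⟨-, ⟨s, s0, es⟩, -⟩ := hax.frame_eq
  rw [es]
  exact ⟨b, hb, (P.interval b).smul_mem _ hm s s0⟩

theorem xPlus_letter_mem (P : PingPong g h A) (s : Letter) : xPlus (wordMap g h [s]) ∈ A s :=
  P.xPlus_mem FreeGroup.IsCyclicallyReduced.singleton

theorem xMinus_letter_mem (P : PingPong g h A) (s : Letter) :
    xMinus (wordMap g h [s]) ∈ A (bar s) := by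
  have h1 := P.isAxisPair (FreeGroup.IsCyclicallyReduced.singleton (x := bar s))
  have h2 := h1.inv
  rw [wordMap_bar, inv_inv] at h2
  obtain ⟨-, ⟨r, r0, er⟩, -⟩ := h2.frame_eq
  rw [er, ← wordMap_bar]
  exact (P.interval _).smul_mem _ (P.xPlus_letter_mem _) r r0

end PingPong

/-- The intervals come in the counterclockwise order `A g⁻¹`, `A h⁻¹`, `A g`, `A h`. -/
structure IsOriented (A : Letter → Set R21) : Prop where
  gm_hm_g : ∀ x ∈ A (0, false), ∀ y ∈ A (1, false), ∀ z ∈ A (0, true), 0 < det3 x y z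
  gm_g_h : ∀ x ∈ A (0, false), ∀ y ∈ A (0, true), ∀ z ∈ A (1, true), 0 < det3 x y z
  hm_g_h : ∀ x ∈ A (1, false), ∀ y ∈ A (0, true), ∀ z ∈ A (1, true), 0 < det3 x y z
  gm_hm_h : ∀ x ∈ A (0, false), ∀ y ∈ A (1, false), ∀ z ∈ A (1, true), 0 < det3 x y z

namespace PingPong

variable {g h : R21 ≃ₗ[ℝ] R21} {A : Letter → Set R21}

/-- Rays of three different intervals have an orientation that depends on the intervals only. -/
theorem det3_pos (P : PingPong g h A) {s t u : Letter} (hst : s ≠ t) (htu : t ≠ u) (hus : u ≠ s)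
    {x y z : R21} (hx : x ∈ A s) (hy : y ∈ A t) (hz : z ∈ A u) (h0 : 0 < det3 x y z) :
    ∀ x' ∈ A s, ∀ y' ∈ A t, ∀ z' ∈ A u, 0 < det3 x' y' z' := by
  intro x' hx' y' hy' z' hz'
  have h1 := (P.interval s).det3_pos (P.mem_future hy) (P.mem_future hz)
    (P.disj _ _ hst.symm _ hy) (P.disj _ _ hus _ hz) hx hx' h0
  rw [det3_rotate] at h1
  have h2 := (P.interval t).det3_pos (P.mem_future hz) (P.mem_future hx')
    (P.disj _ _ htu.symm _ hz) (P.disj _ _ hst _ hx') hy hy' h1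
  rw [det3_rotate] at h2
  have h3 := (P.interval u).det3_pos (P.mem_future hx') (P.mem_future hy')
    (P.disj _ _ hus.symm _ hx') (P.disj _ _ htu _ hy') hz hz' h2
  rwa [det3_rotate] at h3

/-- Since the axes of `g` and `h` cross, the endpoints of the axis of `h` lie on different sides of
the axis of `g`. -/
theorem isOriented (P : PingPong g h A) (hT : IsTransversal g h) (hO : PosOrdered g h) :
    IsOriented A := by
  have hgp := P.xPlus_letter_mem (0, true)
  have hgm := P.xMinus_letter_mem (0, true)
  have hhp := P.xPlus_letter_mem (1, true)
  have hhm := P.xMinus_letter_mem (1, true)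
  have hag := P.isAxisPair (FreeGroup.IsCyclicallyReduced.singleton (x := ((0, true) : Letter)))
  have hah := P.isAxisPair (FreeGroup.IsCyclicallyReduced.singleton (x := ((1, true) : Letter)))
  rw [wordMap_g] at hgp hgm hag
  rw [wordMap_h] at hhp hhm hah
  rw [bar_mk, Bool.not_true] at hgm hhm
  have h1 := P.det3_pos (by decide) (by decide) (by decide) hgm hhm hgp hO
  have h0 : 0 < det3 (xMinus g) (xPlus g) (xPlus h) := by
    obtain ⟨t, ht, hset⟩ := hT
    have htm : t ∈ {x : R21 | ldot x (xZero g) = 0 ∧ ldot x (xZero h) = 0} := by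
      rw [hset]; exact Submodule.mem_span_singleton_self t
    obtain ⟨htg, hth⟩ := htm
    have hng := hag.ldot_neg
    have hnh := hah.ldot_neg
    rw [hah.frame_eq.1, ldot_axis] at hth
    rw [hag.frame_eq.1, ldot_axis] at htg
    have hth' : det3 t (xMinus h) (xPlus h) = 0 := by
      rcases mul_eq_zero.1 hth with h2 | h2
      · exact absurd (neg_eq_zero.1 (inv_eq_zero.1 h2)) hnh.ne
      · exact h2
    have htg' : det3 t (xMinus g) (xPlus g) = 0 := by
      rcases mul_eq_zero.1 htg with h2 | h2
      · exact absurd (neg_eq_zero.1 (inv_eq_zero.1 h2)) hng.ne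
      · exact h2
    have e := sq_smul_eq hah.left_mem.1 hah.right_mem.1 t
    rw [hth', zero_smul, zero_add] at e
    set c := ldot (xMinus h) (xPlus h) with hc
    set α := c * ldot t (xPlus h)
    set β := c * ldot t (xMinus h)
    have hαβ : 0 < α * β := by
      have e2 : ldot (c ^ 2 • t) (c ^ 2 • t) = 2 * (α * β) * c := by
        rw [e]
        simp only [ldot_add_left, ldot_add_right, ldot_smul_left, ldot_smul_right,
          hah.left_mem.1, hah.right_mem.1, ldot_comm (xPlus h) (xMinus h), ← hc]
        ring
      rw [ldot_smul_left, ldot_smul_right] at e2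
      have hc2 : 0 < c ^ 2 := sq_pos_of_neg hnh
      have : 2 * (α * β) * c < 0 := by
        rw [← e2]; exact mul_neg_of_pos_of_neg hc2 (mul_neg_of_pos_of_neg hc2 ht)
      have := pos_of_mul_neg_left this hnh.le
      linarith
    have e3 : α * det3 (xMinus h) (xMinus g) (xPlus g) + β * det3 (xPlus h) (xMinus g) (xPlus g)
        = 0 := by
      have : det3 (c ^ 2 • t) (xMinus g) (xPlus g) = 0 := by rw [det3_smul_left, htg', mul_zero]
      rw [e] at this
      rw [← this]
      simp only [det3_eq, Pi.add_apply, Pi.smul_apply, smul_eq_mul]; ring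
    have hO' : det3 (xMinus h) (xMinus g) (xPlus g) < 0 := by
      have : 0 < det3 (xMinus g) (xMinus h) (xPlus g) := hO
      rw [det3_rotate, det3_swap] at this
      linarith
    rw [← det3_rotate]
    by_contra! hcon
    have h5 : α ^ 2 * det3 (xMinus h) (xMinus g) (xPlus g)
        + (α * β) * det3 (xPlus h) (xMinus g) (xPlus g) = 0 := by
      linear_combination α * e3
    have hα : α ≠ 0 := by rintro h6; rw [h6, zero_mul] at hαβ; exact lt_irrefl _ hαβ
    have : α ^ 2 * det3 (xMinus h) (xMinus g) (xPlus g) < 0 :=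
      mul_neg_of_pos_of_neg (by positivity) hO'
    nlinarith [mul_nonneg hαβ.le (neg_nonneg.2 hcon)]
  have h2 := P.det3_pos (by decide) (by decide) (by decide) hgm hgp hhp h0
  refine ⟨h1, h2, fun x hx y hy z hz => ?_, fun x hx y hy z hz => ?_⟩
  · have a1 := h1 _ hgm x hx y hy
    have a2 := h2 _ hgm y hy z hz
    rw [← det3_rotate] at a1
    rw [det3_rotate] at a2
    rw [det3_rotate]
    exact det3_trans (P.mem_future hy) (P.mem_future hz) (P.mem_future hgm) (P.mem_future hx) a2 a1
  · exact det3_trans (P.mem_future hx) (P.mem_future hy) (P.mem_future hgp) (P.mem_future hz)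
      (h1 x hx y hy _ hgp) (h2 x hx _ hgp z hz)

end PingPong

/-! ### Comparing rays by their itineraries -/

/-- Seen from every ray of `A g⁻¹` and of `A h⁻¹`, the ray of `x` comes counterclockwise after that
of `p`. Both `g` and `h` preserve this relation, so that it can be read off from the words leading
to the two rays. -/
structure Precedes (A : Letter → Set R21) (p x : R21) : Prop where
  left_mem : p ∈ future
  right_mem : x ∈ future
  left_notMem : ∀ i, p ∉ A (i, false)
  right_notMem : ∀ i, x ∉ A (i, false)
  det3_pos : ∀ i, ∀ d ∈ A (i, false), 0 < det3 d p x

/-- The vectors `x` and `y` span the same ray. -/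
def SameRay (x y : R21) : Prop := ∃ r : ℝ, 0 < r ∧ x = r • y

theorem SameRay.map {x y : R21} (hxy : SameRay x y) (w : R21 ≃ₗ[ℝ] R21) :
    SameRay (w x) (w y) := by
  obtain ⟨r, r0, rfl⟩ := hxy
  exact ⟨r, r0, map_smul _ _ _⟩

theorem SameRay.symm {x y : R21} (hxy : SameRay x y) : SameRay y x := by
  obtain ⟨r, r0, rfl⟩ := hxy
  exact ⟨r⁻¹, inv_pos.2 r0, by rw [smul_smul, inv_mul_cancel₀ r0.ne', one_smul]⟩

theorem SameRay.trans {x y z : R21} (hxy : SameRay x y) (hyz : SameRay y z) : SameRay x z := by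
  obtain ⟨r, r0, rfl⟩ := hxy
  obtain ⟨s, s0, rfl⟩ := hyz
  exact ⟨r * s, mul_pos r0 s0, by rw [smul_smul]⟩

theorem SameRay.refl (x : R21) : SameRay x x := ⟨1, one_pos, (one_smul _ _).symm⟩

theorem mem_future_of_sameRay {x y : R21} (hxy : SameRay x y)
    (hy : y ∈ future) : x ∈ future := by
  obtain ⟨r, r0, rfl⟩ := hxy
  exact smul_mem_future hy r0

/-- The word `hⁱ`. -/
abbrev hWord (i : ℕ) : List Letter := List.replicate i (1, true)

/-- The word `g hⁱ`. -/
abbrev ghWord (i : ℕ) : List Letter := (0, true) :: hWord i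

namespace PingPong

variable {g h : R21 ≃ₗ[ℝ] R21} {A : Letter → Set R21}

theorem mem_of_sameRay (P : PingPong g h A) {s : Letter} {x y : R21} (hxy : SameRay x y)
    (hy : y ∈ A s) : x ∈ A s := by
  obtain ⟨r, r0, rfl⟩ := hxy
  exact (P.interval s).smul_mem _ hy r r0

theorem precedes_congr (P : PingPong g h A) {p p' x x' : R21} (hp : SameRay p p')
    (hx : SameRay x x') (hpx : Precedes A p' x') : Precedes A p x := by
  refine ⟨mem_future_of_sameRay hp hpx.left_mem, mem_future_of_sameRay hx hpx.right_mem,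
    fun i hi => hpx.left_notMem i (P.mem_of_sameRay hp.symm hi),
    fun i hi => hpx.right_notMem i (P.mem_of_sameRay hx.symm hi), fun i d hd => ?_⟩
  obtain ⟨r, r0, rfl⟩ := hp
  obtain ⟨s, s0, rfl⟩ := hx
  rw [det3_smul_mid, det3_smul_right]
  exact mul_pos r0 (mul_pos s0 (hpx.det3_pos i d hd))

/-- The letter `s` transports an order seen from the rays of `A s⁻¹` to an order seen from all rays
outside of `A s`. -/
theorem det3_map_pos (P : PingPong g h A) (s : Letter) {p x d : R21}
    (hpx : ∀ d ∈ A (bar s), 0 < det3 d p x) (hd : d ∈ future) (hds : d ∉ A s) :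
    0 < det3 d (wordMap g h [s] p) (wordMap g h [s] x) := by
  have h1 : (wordMap g h [s])⁻¹ d ∈ A (bar s) := by
    rw [← wordMap_bar]
    exact P.maps _ _ hd (by rwa [bar_bar])
  have h2 := hpx _ h1
  rw [← (P.isSO21_letter s).det3_map] at h2
  have h3 : wordMap g h [s] ((wordMap g h [s])⁻¹ d) = d := by
    rw [← LinearEquiv.mul_apply, mul_inv_cancel]; rfl
  rwa [h3] at h2

theorem map_positive_mem (P : PingPong g h A) (i : Fin 2) {x : R21} (hx : x ∈ future)
    (hx' : x ∉ A (i, false)) : wordMap g h [(i, true)] x ∈ A (i, true) :=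
  P.maps (i, true) x hx hx'

theorem precedes_map (P : PingPong g h A) (i : Fin 2) {p x : R21} (hpx : Precedes A p x) :
    Precedes A (wordMap g h [(i, true)] p) (wordMap g h [(i, true)] x) := by
  have hp := P.map_positive_mem i hpx.left_mem (hpx.left_notMem i)
  have hx := P.map_positive_mem i hpx.right_mem (hpx.right_notMem i)
  refine ⟨P.mem_future hp, P.mem_future hx, fun j => P.disj _ _ (by simp) _ hp,
    fun j => P.disj _ _ (by simp) _ hx, fun j d hd => ?_⟩
  exact P.det3_map_pos (i, true) (hpx.det3_pos i) (P.mem_future hd) (P.disj _ _ (by simp) _ hd)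

theorem precedes_of_mem (P : PingPong g h A) (O : IsOriented A) {p x : R21}
    (hp : p ∈ A (0, true)) (hx : x ∈ A (1, true)) : Precedes A p x := by
  refine ⟨P.mem_future hp, P.mem_future hx, fun j => P.disj _ _ (by simp) _ hp,
    fun j => P.disj _ _ (by simp) _ hx, fun j d hd => ?_⟩
  fin_cases j
  · exact O.gm_g_h d hd p hp x hx
  · exact O.hm_g_h d hd p hp x hx

theorem hWord_map_mem (P : PingPong g h A) {x : R21} (hx : x ∈ future) (hx' : x ∉ A (1, false))
    (j : ℕ) : wordMap g h (hWord (j + 1)) x ∈ A (1, true) := by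
  induction j with
  | zero => simpa [hWord] using P.map_positive_mem 1 hx hx'
  | succ j ih =>
    rw [hWord, List.replicate_succ, wordMap_cons_apply]
    exact P.map_positive_mem 1 (P.mem_future ih) (P.disj _ _ (by simp) _ ih)

theorem precedes_hWord_map (P : PingPong g h A) {p x : R21} (hpx : Precedes A p x) (i : ℕ) :
    Precedes A (wordMap g h (hWord i) p) (wordMap g h (hWord i) x) := by
  induction i with
  | zero => simpa [hWord, wordMap_nil_apply] using hpx
  | succ i ih =>
    rw [hWord, List.replicate_succ, wordMap_cons_apply, wordMap_cons_apply]
    exact P.precedes_map 1 ih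

theorem hWord_add_apply (g h : R21 ≃ₗ[ℝ] R21) (i j : ℕ) (x : R21) :
    wordMap g h (hWord (i + j)) x = wordMap g h (hWord i) (wordMap g h (hWord j) x) := by
  rw [hWord, List.replicate_add, wordMap_append_apply]

/-- The more often `h` is applied, the closer a ray is to the attracting ray of `h`. -/
theorem precedes_hWord (P : PingPong g h A) (O : IsOriented A) {p x : R21} (hp : p ∈ A (0, true))
    (hx : x ∈ future) (hx' : x ∉ A (1, false)) {i j : ℕ} (hij : i < j) :
    Precedes A (wordMap g h (hWord i) p) (wordMap g h (hWord j) x) := by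
  obtain ⟨k, rfl⟩ := Nat.exists_eq_add_of_lt hij
  rw [add_assoc, hWord_add_apply]
  exact P.precedes_hWord_map (P.precedes_of_mem O hp (P.hWord_map_mem hx hx' k)) i

theorem precedes_hWord_of_mem (P : PingPong g h A) (O : IsOriented A) {p x : R21}
    (hp : p ∈ A (0, true)) (hx : x ∈ A (0, true)) {i j : ℕ} (hij : i < j) :
    Precedes A (wordMap g h (hWord i) p) (wordMap g h (hWord j) x) :=
  P.precedes_hWord O hp (P.mem_future hx) (P.disj _ _ (by decide) _ hx) hij

theorem precedes_ghWord (P : PingPong g h A) (O : IsOriented A) {p x : R21}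
    (hp : p ∈ A (0, true)) (hx : x ∈ A (0, true)) {i j : ℕ} (hij : i < j) :
    Precedes A (wordMap g h (ghWord i) p) (wordMap g h (ghWord j) x) := by
  rw [wordMap_cons_apply, wordMap_cons_apply]
  exact P.precedes_map 0 (P.precedes_hWord_of_mem O hp hx hij)

/-! ### The sign of the neutral eigenvector on lightlike vectors -/

theorem ldot_xZero_pos (P : PingPong g h A) {L : List Letter}
    (hr : FreeGroup.IsCyclicallyReduced ((0, true) :: L)) {x p x' : R21}
    (hp : SameRay (xPlus (wordMap g h ((0, true) :: L))) (wordMap g h [(0, true)] p))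
    (hx : SameRay x' (wordMap g h [(0, true)] x)) (hpx : ∀ d ∈ A (0, false), 0 < det3 d p x) :
    0 < ldot x' (xZero (wordMap g h ((0, true) :: L))) := by
  obtain ⟨b, hb, hm⟩ := P.exists_xMinus_mem hr
  have hax := P.isAxisPair hr
  rw [hax.frame_eq.1, ldot_axis]
  refine mul_pos (inv_pos.2 (neg_pos.2 hax.ldot_neg)) ?_
  obtain ⟨r, r0, er⟩ := hp
  obtain ⟨s, s0, es⟩ := hx
  rw [er, es, det3_smul_left, det3_smul_right, det3_rotate]
  exact mul_pos s0 (mul_pos r0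
    (P.det3_map_pos (0, true) hpx (P.mem_future hm) (P.disj _ _ hb _ hm)))

theorem ldot_xZero_neg (P : PingPong g h A) {L : List Letter}
    (hr : FreeGroup.IsCyclicallyReduced ((0, true) :: L)) {x p x' : R21}
    (hp : SameRay (xPlus (wordMap g h ((0, true) :: L))) (wordMap g h [(0, true)] p))
    (hx : SameRay x' (wordMap g h [(0, true)] x)) (hpx : ∀ d ∈ A (0, false), 0 < det3 d x p) :
    ldot x' (xZero (wordMap g h ((0, true) :: L))) < 0 := by
  obtain ⟨b, hb, hm⟩ := P.exists_xMinus_mem hr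
  have hax := P.isAxisPair hr
  rw [hax.frame_eq.1, ldot_axis]
  refine mul_neg_of_pos_of_neg (inv_pos.2 (neg_pos.2 hax.ldot_neg)) ?_
  obtain ⟨r, r0, er⟩ := hp
  obtain ⟨s, s0, es⟩ := hx
  rw [er, es, det3_smul_left, det3_smul_right, det3_rotate, det3_swap, mul_neg, mul_neg, neg_lt_zero]
  exact mul_pos s0 (mul_pos r0
    (P.det3_map_pos (0, true) hpx (P.mem_future hm) (P.disj _ _ hb _ hm)))

theorem ldot_xPlus_xZero (P : PingPong g h A) {L : List Letter} {a : Letter}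
    (hr : FreeGroup.IsCyclicallyReduced (a :: L)) :
    ldot (xPlus (wordMap g h (a :: L))) (xZero (wordMap g h (a :: L))) = 0 := by
  rw [(P.isAxisPair hr).frame_eq.1, ldot_comm, ldot_axis_right]

theorem sameRay_xPlus (P : PingPong g h A) {L : List Letter} {a : Letter}
    (hr : FreeGroup.IsCyclicallyReduced (a :: L)) :
    SameRay (xPlus (wordMap g h (a :: L))) (wordMap g h (a :: L) (xPlus (wordMap g h (a :: L)))) := by
  obtain ⟨l, l0, l1, -, ep⟩ := (P.isAxisPair hr).exists_eigenvalue
  exact SameRay.symm ⟨l⁻¹, inv_pos.2 l0, ep⟩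

/-- The attracting ray of a cyclically reduced word `v s u` lies in the image under `v` of the
interval of the letter `s`. -/
theorem exists_sameRay_xPlus (P : PingPong g h A) {M N : List Letter} {a s : Letter}
    (hr : FreeGroup.IsCyclicallyReduced (a :: M ++ s :: N)) :
    ∃ p ∈ A s, SameRay (xPlus (wordMap g h (a :: M ++ s :: N))) (wordMap g h (a :: M) p) := by
  have h1 := P.sameRay_xPlus (L := M ++ s :: N) hr
  refine ⟨wordMap g h (s :: N) (xPlus (wordMap g h (a :: M ++ s :: N))),
    P.wordMap_mem N s a ?_ _ (P.xPlus_mem (L := M ++ s :: N) hr), ?_⟩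
  · rw [isCyclicallyReduced_iff_append_self] at hr
    exact hr.infix ⟨a :: M, M ++ s :: N, by simp⟩
  · rw [← wordMap_append_apply]
    exact h1

end PingPong

/-! ### The two translation vectors -/

theorem isCyclicallyReduced_of_positive {L : List Letter} (hL : ∀ s ∈ L, s.2 = true) :
    FreeGroup.IsCyclicallyReduced L := by
  rw [isCyclicallyReduced_iff_append_self]
  have : ∀ M : List Letter, (∀ s ∈ M, s.2 = true) → FreeGroup.IsReduced M := by
    intro M
    induction M with
    | nil => intro _; exact FreeGroup.IsReduced.nil
    | cons a M ih =>
      intro hM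
      refine List.isChain_cons.2 ⟨fun b hb _ => ?_, ih fun s hs => hM s (List.mem_cons_of_mem _ hs)⟩
      rw [hM a List.mem_cons_self, hM b (List.mem_cons_of_mem _ (List.mem_of_mem_head? hb))]
  exact this _ fun s hs => hL s (by simpa using hs)

theorem ghWord_positive (i : ℕ) : ∀ s ∈ ghWord i, s.2 = true := by
  intro s hs
  rcases List.mem_cons.1 hs with rfl | hs
  · rfl
  · rw [List.eq_of_mem_replicate hs]

theorem isCyclicallyReduced_ghWord (i : ℕ) : FreeGroup.IsCyclicallyReduced (ghWord i) :=
  isCyclicallyReduced_of_positive (ghWord_positive i)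

theorem isCyclicallyReduced_ghWord_append (i j : ℕ) :
    FreeGroup.IsCyclicallyReduced (ghWord i ++ ghWord j) :=
  isCyclicallyReduced_of_positive fun s hs =>
    (List.mem_append.1 hs).elim (ghWord_positive i s) (ghWord_positive j s)

/-- The attracting eigenvector of `g hᵏ g hᵏ⁺¹`. -/
def lowerPoint (g h : R21 ≃ₗ[ℝ] R21) (k : ℕ) : R21 :=
  xPlus (wordMap g h (ghWord k ++ ghWord (k + 1)))

/-- The attracting eigenvector of `g hᵏ⁺¹`. -/
def upperPoint (g h : R21 ≃ₗ[ℝ] R21) (k : ℕ) : R21 := xPlus (wordMap g h (ghWord (k + 1)))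

namespace PingPong

variable {g h : R21 ≃ₗ[ℝ] R21} {A : Letter → Set R21}

theorem upperPoint_mem (P : PingPong g h A) (k : ℕ) : upperPoint g h k ∈ A (0, true) :=
  P.xPlus_mem (isCyclicallyReduced_ghWord _)

theorem sameRay_upperPoint (P : PingPong g h A) (k : ℕ) :
    SameRay (upperPoint g h k) (wordMap g h (ghWord (k + 1)) (upperPoint g h k)) :=
  P.sameRay_xPlus (isCyclicallyReduced_ghWord _)

theorem lowerPoint_mem (P : PingPong g h A) (k : ℕ) : lowerPoint g h k ∈ A (0, true) :=
  P.xPlus_mem (L := hWord k ++ ghWord (k + 1)) (isCyclicallyReduced_ghWord_append _ _)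

theorem ghWord_map_mem (P : PingPong g h A) (i : ℕ) {x : R21} (hx : x ∈ A (0, true)) :
    wordMap g h (ghWord i) x ∈ A (0, true) := by
  refine P.wordMap_mem _ _ _ ?_ x hx
  have := (isCyclicallyReduced_iff_append_self _).1 (isCyclicallyReduced_ghWord i)
  exact this.infix ⟨[], hWord i, by simp⟩

theorem sameRay_lowerPoint (P : PingPong g h A) (k : ℕ) :
    SameRay (lowerPoint g h k)
      (wordMap g h (ghWord k) (wordMap g h (ghWord (k + 1)) (lowerPoint g h k))) := by
  rw [← wordMap_append_apply]
  exact P.sameRay_xPlus (L := hWord k ++ ghWord (k + 1)) (isCyclicallyReduced_ghWord_append _ _)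

/-- The itineraries need only be compared after the common first letter `g`. -/
theorem ldot_xZero_pos_of_precedes (P : PingPong g h A) {L : List Letter}
    (hr : FreeGroup.IsCyclicallyReduced ((0, true) :: L)) {x p x' : R21}
    {M N : List Letter}
    (hp : SameRay (xPlus (wordMap g h ((0, true) :: L))) (wordMap g h ((0, true) :: M) p))
    (hx : SameRay x' (wordMap g h ((0, true) :: N) x))
    (hpx : Precedes A (wordMap g h M p) (wordMap g h N x)) :
    0 < ldot x' (xZero (wordMap g h ((0, true) :: L))) := by
  rw [wordMap_cons_apply] at hp hx
  exact P.ldot_xZero_pos hr hp hx (hpx.det3_pos 0)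

theorem ldot_xZero_neg_of_precedes (P : PingPong g h A) {L : List Letter}
    (hr : FreeGroup.IsCyclicallyReduced ((0, true) :: L)) {x p x' : R21}
    {M N : List Letter}
    (hp : SameRay (xPlus (wordMap g h ((0, true) :: L))) (wordMap g h ((0, true) :: M) p))
    (hx : SameRay x' (wordMap g h ((0, true) :: N) x))
    (hpx : Precedes A (wordMap g h N x) (wordMap g h M p)) :
    ldot x' (xZero (wordMap g h ((0, true) :: L))) < 0 := by
  rw [wordMap_cons_apply] at hp hx
  exact P.ldot_xZero_neg hr hp hx (hpx.det3_pos 0)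

/-- The two points come after the attracting rays of `g hⁱ` for `i ≤ k`. For `i = k` both
itineraries begin with `g hᵏ`, and their continuations `g hᵏ ⋯` and `g hᵏ⁺¹ ⋯` decide. -/
theorem ldot_ghWord_pos (P : PingPong g h A) (O : IsOriented A) {i k : ℕ} (hik : i ≤ k) :
    0 < ldot (lowerPoint g h k) (xZero (wordMap g h (ghWord i))) ∧
      0 < ldot (upperPoint g h k) (xZero (wordMap g h (ghWord i))) := by
  have hr := isCyclicallyReduced_ghWord i
  have hp := P.sameRay_xPlus hr
  have hpm := P.xPlus_mem hr
  set p := xPlus (wordMap g h (ghWord i))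
  constructor
  · refine P.ldot_xZero_pos_of_precedes hr hp (P.sameRay_lowerPoint k) ?_
    have hl := P.ghWord_map_mem (k + 1) (P.lowerPoint_mem k)
    rcases hik.lt_or_eq with hlt | rfl
    · exact P.precedes_hWord_of_mem O hpm hl hlt
    · refine P.precedes_hWord_map (P.precedes_congr hp (SameRay.refl _) ?_) i
      exact P.precedes_ghWord O hpm (P.lowerPoint_mem i) (Nat.lt_succ_self i)
  · exact P.ldot_xZero_pos_of_precedes hr hp (P.sameRay_upperPoint k)
      (P.precedes_hWord_of_mem O hpm (P.upperPoint_mem k) (by omega))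

theorem ldot_ghWord_append_g_pos (P : PingPong g h A) (O : IsOriented A) {i k : ℕ} (hik : i < k)
    {N : List Letter} (hr : FreeGroup.IsCyclicallyReduced (ghWord i ++ (0, true) :: N)) :
    0 < ldot (lowerPoint g h k) (xZero (wordMap g h (ghWord i ++ (0, true) :: N))) ∧
      0 < ldot (upperPoint g h k) (xZero (wordMap g h (ghWord i ++ (0, true) :: N))) := by
  obtain ⟨p, hpm, hp⟩ := P.exists_sameRay_xPlus hr
  exact ⟨P.ldot_xZero_pos_of_precedes hr hp (P.sameRay_lowerPoint k)
      (P.precedes_hWord_of_mem O hpm (P.ghWord_map_mem (k + 1) (P.lowerPoint_mem k)) hik),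
    P.ldot_xZero_pos_of_precedes hr hp (P.sameRay_upperPoint k)
      (P.precedes_hWord_of_mem O hpm (P.upperPoint_mem k) (by omega))⟩

theorem ldot_g_h_inv_pos (P : PingPong g h A) (O : IsOriented A) {k : ℕ} (hk : 1 ≤ k)
    {N : List Letter} (hr : FreeGroup.IsCyclicallyReduced ((0, true) :: (1, false) :: N)) :
    0 < ldot (lowerPoint g h k) (xZero (wordMap g h ((0, true) :: (1, false) :: N))) ∧
      0 < ldot (upperPoint g h k) (xZero (wordMap g h ((0, true) :: (1, false) :: N))) := by
  obtain ⟨p, hpm, hp⟩ := P.exists_sameRay_xPlus (M := []) hr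
  have hl := P.sameRay_lowerPoint k
  have hu := P.sameRay_upperPoint k
  rw [wordMap_cons_apply] at hl hu
  obtain ⟨j, rfl⟩ := Nat.exists_eq_add_of_le' hk
  have hl' := P.ghWord_map_mem (j + 1 + 1) (P.lowerPoint_mem (j + 1))
  have hu' := P.upperPoint_mem (j + 1)
  exact ⟨P.ldot_xZero_pos hr hp hl fun d hd => O.gm_hm_h d hd p hpm _
      (P.hWord_map_mem (P.mem_future hl') (P.disj _ _ (by decide) _ hl') _),
    P.ldot_xZero_pos hr hp hu fun d hd => O.gm_hm_h d hd p hpm _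
      (P.hWord_map_mem (P.mem_future hu') (P.disj _ _ (by decide) _ hu') _)⟩

/-- The lower point comes before the attracting ray of `g hᵏ⁺¹`, which is the upper point. -/
theorem ldot_lowerPoint_ghWord_succ_neg (P : PingPong g h A) (O : IsOriented A) (k : ℕ) :
    ldot (lowerPoint g h k) (xZero (wordMap g h (ghWord (k + 1)))) < 0 :=
  P.ldot_xZero_neg_of_precedes (isCyclicallyReduced_ghWord _) (P.sameRay_upperPoint k)
    (P.sameRay_lowerPoint k)
    (P.precedes_hWord_of_mem O (P.ghWord_map_mem _ (P.lowerPoint_mem k)) (P.upperPoint_mem k)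
      (Nat.lt_succ_self k))

theorem ldot_upperPoint_ghWord_succ (P : PingPong g h A) (k : ℕ) :
    ldot (upperPoint g h k) (xZero (wordMap g h (ghWord (k + 1)))) = 0 :=
  P.ldot_xPlus_xZero (isCyclicallyReduced_ghWord _)

theorem ldot_lowerPoint_neg (P : PingPong g h A) (O : IsOriented A) (k : ℕ) :
    ldot (lowerPoint g h k) (xZero (wordMap g h (ghWord (k + 1) ++ ghWord k))) < 0 := by
  have hr := isCyclicallyReduced_ghWord_append (k + 1) k
  obtain ⟨p, hpm, hp⟩ := P.exists_sameRay_xPlus hr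
  exact P.ldot_xZero_neg_of_precedes hr hp (P.sameRay_lowerPoint k)
    (P.precedes_hWord_of_mem O (P.ghWord_map_mem _ (P.lowerPoint_mem k)) hpm (Nat.lt_succ_self k))

theorem ldot_lowerPoint_eq_zero (P : PingPong g h A) (k : ℕ) :
    ldot (lowerPoint g h k) (xZero (wordMap g h (ghWord k ++ ghWord (k + 1)))) = 0 :=
  P.ldot_xPlus_xZero (L := hWord k ++ ghWord (k + 1)) (isCyclicallyReduced_ghWord_append _ _)

theorem ldot_upperPoint_pos (P : PingPong g h A) (O : IsOriented A) (k : ℕ) :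
    0 < ldot (upperPoint g h k) (xZero (wordMap g h (ghWord k ++ ghWord (k + 1)))) := by
  have hr := isCyclicallyReduced_ghWord_append k (k + 1)
  obtain ⟨p, hpm, hp⟩ := P.exists_sameRay_xPlus hr
  exact P.ldot_xZero_pos_of_precedes hr hp (P.sameRay_upperPoint k)
    (P.precedes_hWord_of_mem O hpm (P.upperPoint_mem k) (Nat.lt_succ_self k))

theorem ldot_upperPoint_swap_pos (P : PingPong g h A) (O : IsOriented A) (k : ℕ) :
    0 < ldot (upperPoint g h k) (xZero (wordMap g h (ghWord (k + 1) ++ ghWord k))) := by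
  have hr := isCyclicallyReduced_ghWord_append (k + 1) k
  have hp := P.sameRay_xPlus (L := hWord (k + 1) ++ ghWord k) hr
  have hpm := P.xPlus_mem (L := hWord (k + 1) ++ ghWord k) hr
  rw [← List.cons_append, wordMap_append_apply] at hp
  refine P.ldot_xZero_pos_of_precedes hr hp (P.sameRay_upperPoint k) ?_
  refine P.precedes_hWord_map (P.precedes_congr (SameRay.refl _) (P.sameRay_upperPoint k) ?_) _
  exact P.precedes_ghWord O hpm (P.upperPoint_mem k) (Nat.lt_succ_self k)

/-! ### Membership in the interval of Property C -/

/-- A ray between `e` and `f`, seen from all rays outside of `A g`, lies in the interval of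
`A g` bounded by `e` and `f`. -/
theorem mem_intervalIn (P : PingPong g h A) {e f x : R21} (he : e ∈ A (0, true))
    (hf : f ∈ A (0, true)) (hx : x ∈ A (0, true))
    (hef : ∀ d ∈ future, d ∉ A (0, true) → 0 < det3 d e f)
    (hex : ∀ d ∈ future, d ∉ A (0, true) → 0 < det3 d e x)
    (hxf : ∀ d ∈ future, d ∉ A (0, true) → 0 < det3 d x f) :
    x ∈ intervalIn (A (0, true)) e f := by
  refine Or.inl ⟨fun y hy => ?_, P.mem_future hx, ?_⟩
  · by_contra hyA
    have h1 := hef y hy.1 hyA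
    have h2 := hy.2
    simp only [det3_eq] at h1 h2
    linarith
  · obtain ⟨d, hd⟩ := (P.interval (0, false)).isConnected.nonempty
    have hdf := P.mem_future hd
    have hdA := P.disj _ (0, true) (by decide) _ hd
    have h1 := hex d hdf hdA
    have h2 := hxf d hdf hdA
    -- From `d, e, x` and `d, x, f` being in counterclockwise order follows the order of `e, x, f`.
    rw [det3_rotate] at h2
    have h3 : 0 < det3 x d e := by rw [det3_rotate]; exact h1
    have h4 := det3_trans (P.mem_future hx) (P.mem_future hf) hdf (P.mem_future he) h2 h3
    rw [← det3_rotate] at h4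
    exact h4.le

theorem det3_g_pos (P : PingPong g h A) {p x p' x' : R21} {M N : List Letter}
    (hp : SameRay p' (wordMap g h ((0, true) :: M) p))
    (hx : SameRay x' (wordMap g h ((0, true) :: N) x))
    (hpx : Precedes A (wordMap g h M p) (wordMap g h N x)) :
    ∀ d ∈ future, d ∉ A (0, true) → 0 < det3 d p' x' := by
  intro d hd hdA
  rw [wordMap_cons_apply] at hp hx
  obtain ⟨r, r0, rfl⟩ := hp
  obtain ⟨s, s0, rfl⟩ := hx
  rw [det3_smul_mid, det3_smul_right]
  exact mul_pos r0 (mul_pos s0 (P.det3_map_pos (0, true) (hpx.det3_pos 0) hd hdA))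

theorem sameRay_hWord_xPlus (P : PingPong g h A) (i : ℕ) :
    SameRay (xPlus h) (wordMap g h (hWord i) (xPlus h)) := by
  have h1 := P.sameRay_xPlus (FreeGroup.IsCyclicallyReduced.singleton (x := ((1, true) : Letter)))
  rw [wordMap_h] at h1
  induction i with
  | zero => rw [hWord, List.replicate_zero, wordMap_nil_apply]; exact SameRay.refl _
  | succ i ih =>
    rw [hWord, List.replicate_succ, wordMap_cons_apply, wordMap_h]
    exact h1.trans (ih.map h)

theorem points_mem_intervalIn (P : PingPong g h A) (O : IsOriented A) {k : ℕ} (hk : 1 ≤ k) :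
    lowerPoint g h k ∈ intervalIn (A (0, true)) (xPlus (g * h)) (g (xPlus h)) ∧
      upperPoint g h k ∈ intervalIn (A (0, true)) (xPlus (g * h)) (g (xPlus h)) := by
  have hgh : wordMap g h (ghWord 1) = g * h := by
    rw [wordMap_cons, wordMap_g, hWord, List.replicate_one, wordMap_h]
  have he := P.sameRay_xPlus (isCyclicallyReduced_ghWord 1)
  have hem := P.xPlus_mem (isCyclicallyReduced_ghWord 1)
  have hhm := P.xPlus_letter_mem (1, true)
  rw [wordMap_h] at hhm
  have hfi : ∀ i, SameRay (g (xPlus h)) (wordMap g h (ghWord i) (xPlus h)) := fun i => by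
    rw [wordMap_cons_apply, wordMap_g]; exact (P.sameRay_hWord_xPlus i).map g
  have hfm : g (xPlus h) ∈ A (0, true) := by
    have := P.map_positive_mem 0 (P.mem_future hhm) (P.disj _ _ (by decide) _ hhm)
    rwa [wordMap_g] at this
  rw [← hgh]
  set e := xPlus (wordMap g h (ghWord 1))
  have hl := P.sameRay_lowerPoint k
  have hlm := P.lowerPoint_mem k
  have hlm' := P.ghWord_map_mem (k + 1) hlm
  have hu := P.sameRay_upperPoint k
  have hum := P.upperPoint_mem k
  have key : ∀ {p : R21}, p ∈ A (0, true) → ∀ i,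
      Precedes A (wordMap g h (hWord i) p) (wordMap g h (hWord i) (xPlus h)) := fun hp i =>
    P.precedes_hWord_map (P.precedes_of_mem O hp hhm) i
  have hef := P.det3_g_pos he (hfi 1) (key hem 1)
  constructor
  · refine P.mem_intervalIn hem hfm hlm hef (P.det3_g_pos he hl ?_)
      (P.det3_g_pos hl (hfi k) (key hlm' k))
    rcases hk.lt_or_eq with hk | rfl
    · exact P.precedes_hWord_of_mem O hem hlm' hk
    · refine P.precedes_hWord_map (P.precedes_congr he (SameRay.refl _) ?_) 1
      exact P.precedes_ghWord O hem hlm (by omega)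
  · exact P.mem_intervalIn hem hfm hum hef
      (P.det3_g_pos he hu (P.precedes_hWord_of_mem O hem hum (by omega)))
      (P.det3_g_pos hu (hfi (k + 1)) (key hum (k + 1)))

end PingPong

/-! ### The Margulis invariant as a sum over the rotations of a word -/

section Cocycle
variable (g h : R21 ≃ₗ[ℝ] R21)

/-- The translational part of a letter, if `v 0` and `v 1` are those of the generators. -/
def letterTrans (v : Fin 2 → R21) (a : Letter) : R21 :=
  if a.2 then v a.1 else -wordMap g h [a] (v a.1)

/-- The translational part of a word, if `v 0` and `v 1` are those of the generators. -/
def trans (v : Fin 2 → R21) : List Letter → R21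
  | [] => 0
  | a :: L => letterTrans g h v a + wordMap g h [a] (trans v L)

theorem letterTrans_add_smul (v v' : Fin 2 → R21) (r : ℝ) (a : Letter) :
    letterTrans g h (v + r • v') a = letterTrans g h v a + r • letterTrans g h v' a := by
  simp only [letterTrans, Pi.add_apply, Pi.smul_apply]
  split_ifs
  · rfl
  · rw [map_add, map_smul, neg_add, smul_neg]

theorem trans_add_smul (v v' : Fin 2 → R21) (r : ℝ) (L : List Letter) :
    trans g h (v + r • v') L = trans g h v L + r • trans g h v' L := by
  induction L with
  | nil => simp [trans]
  | cons a L ih =>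
    simp only [trans, ih, letterTrans_add_smul, map_add, map_smul, smul_add]
    abel

theorem trans_append (v : Fin 2 → R21) (L M : List Letter) :
    trans g h v (L ++ M) = trans g h v L + wordMap g h L (trans g h v M) := by
  induction L with
  | nil => simp [trans, wordMap_nil_apply]
  | cons a L ih =>
    rw [List.cons_append, trans, trans, ih, map_add, wordMap_cons_apply g h a L, add_assoc]

/-- The Margulis invariant of a word, if `v 0` and `v 1` are the translational parts of the
generators. -/
def wordMargulis (v : Fin 2 → R21) (L : List Letter) : ℝ :=
  ldot (trans g h v L) (xZero (wordMap g h L))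

theorem wordMargulis_add_smul (v v' : Fin 2 → R21) (r : ℝ) (L : List Letter) :
    wordMargulis g h (v + r • v') L = wordMargulis g h v L + r * wordMargulis g h v' L := by
  rw [wordMargulis, trans_add_smul, ldot_add_left, ldot_smul_left]; rfl

end Cocycle

/-- The word, or its inverse rotated by one letter, whichever begins with a generator. -/
def positiveRotation : List Letter → List Letter
  | [] => []
  | (i, true) :: L => (i, true) :: L
  | (i, false) :: L => (i, true) :: FreeGroup.invRev L

theorem isCyclicallyReduced_positiveRotation {L : List Letter}
    (hr : FreeGroup.IsCyclicallyReduced L) :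
    FreeGroup.IsCyclicallyReduced (positiveRotation L) := by
  match L with
  | [] => exact hr
  | (i, true) :: L => exact hr
  | (i, false) :: L =>
    have h1 := isCyclicallyReduced_append_comm (L := [(i, false)]) (M := L) hr
    have h2 := isCyclicallyReduced_invRev h1
    rwa [invRev_concat] at h2

/-- The contribution of the first letter of a word to its Margulis invariant. -/
def headTerm (g h : R21 ≃ₗ[ℝ] R21) (v : Fin 2 → R21) (L : List Letter) : ℝ :=
  match L with
  | [] => 0
  | a :: _ => ldot (v a.1) (xZero (wordMap g h (positiveRotation L)))

namespace PingPong

variable {g h : R21 ≃ₗ[ℝ] R21} {A : Letter → Set R21}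

/-- Rotating a word by its first letter conjugates the isometry by that letter. -/
theorem xZero_rotate (P : PingPong g h A) {L : List Letter} {a : Letter}
    (hr : FreeGroup.IsCyclicallyReduced (a :: L)) :
    (wordMap g h [a])⁻¹ (xZero (wordMap g h (a :: L))) = xZero (wordMap g h (L ++ [a])) := by
  have h1 := xZero_conj (P.isAxisPair hr) (P.isSO21_letter a).inv
  rw [← h1, wordMap_append, wordMap_cons g h a L, inv_mul_cancel_left, inv_inv]

theorem ldot_letterTrans (P : PingPong g h A) (v : Fin 2 → R21) {L : List Letter} {a : Letter}
    (hr : FreeGroup.IsCyclicallyReduced (a :: L)) :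
    ldot (letterTrans g h v a) (xZero (wordMap g h (a :: L))) = headTerm g h v (a :: L) := by
  obtain ⟨i, b⟩ := a
  cases b
  · have h1 : FreeGroup.IsCyclicallyReduced (positiveRotation ((i, false) :: L)) :=
      isCyclicallyReduced_positiveRotation hr
    simp only [positiveRotation] at h1
    have h2 : (i, true) :: FreeGroup.invRev L = FreeGroup.invRev (L ++ [(i, false)]) := by
      rw [invRev_concat]; rfl
    have h3 := xZero_inv (P.isAxisPair h1)
    rw [h2, wordMap_invRev, inv_inv] at h3
    simp only [letterTrans, headTerm, positiveRotation, Bool.false_eq_true, if_false]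
    rw [ldot_neg_left, (P.isSO21_letter _).ldot_inv_left, P.xZero_rotate hr, h3, ldot_neg_right,
      neg_neg, h2, wordMap_invRev]
  · simp [letterTrans, headTerm, positiveRotation]

theorem ldot_trans_eq_sum (P : PingPong g h A) (v : Fin 2 → R21) (L : List Letter) :
    ∀ M : List Letter, FreeGroup.IsCyclicallyReduced (L ++ M) →
      ldot (trans g h v L) (xZero (wordMap g h (L ++ M))) =
        ∑ j ∈ Finset.range L.length, headTerm g h v ((L ++ M).rotate j) := by
  induction L with
  | nil => intro M _; simp [trans, ldot]
  | cons a L ih =>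
    intro M hr
    have hr' := isCyclicallyReduced_append_comm (L := [a]) (M := L ++ M) hr
    rw [List.append_assoc] at hr'
    rw [List.cons_append] at hr
    rw [List.length_cons, Finset.sum_range_succ', trans, ldot_add_left,
      (P.isSO21_letter a).ldot_inv_left, List.cons_append, P.xZero_rotate hr, List.append_assoc,
      ih _ hr', P.ldot_letterTrans v hr, add_comm]
    simp

/-- The Margulis invariant of a cyclically reduced word is the sum of the contributions of its
letters, each of which is the value of the translational part of a generator on the neutral vector
of a word beginning with that generator. -/
theorem wordMargulis_eq_sum (P : PingPong g h A) (v : Fin 2 → R21) {L : List Letter}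
    (hr : FreeGroup.IsCyclicallyReduced L) :
    wordMargulis g h v L = ∑ j ∈ Finset.range L.length, headTerm g h v (L.rotate j) := by
  have := P.ldot_trans_eq_sum v L [] (by simpa using hr)
  simpa [wordMargulis] using this

end PingPong

/-! ### Counting the subwords `g hⁱ g⁻¹` -/

/-- Whether the first letter of a word other than `h` and `h⁻¹` is `g⁻¹`. -/
def gInvAhead : List Letter → ℝ
  | [] => 0
  | (0, true) :: _ => 0
  | (0, false) :: _ => 1
  | (1, _) :: L => gInvAhead L

/-- The sign of the exponent of `h` with which a word begins. -/
def hSign : List Letter → ℝ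
  | (1, true) :: _ => 1
  | (1, false) :: _ => -1
  | _ => 0

/-- For words beginning with `g`: this is `-1` for `g hⁱ g⁻¹ ⋯` and `1` for `g h⁻ⁱ g⁻¹ ⋯` with
`i > 0`, and `0` otherwise. -/
def typeSign : List Letter → ℝ
  | (0, true) :: L => -(gInvAhead L * hSign L)
  | _ => 0

/-- For a cyclic word cut open inside of a subword `g hⁱ g⁻¹` this is minus the sign of `i`, and it
is `0` for other cuts. -/
def cutSign (L : List Letter) : ℝ :=
  -(gInvAhead L * gInvAhead (FreeGroup.invRev L) *
    (if hSign L = 0 then -hSign (FreeGroup.invRev L) else hSign L))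

theorem gInvAhead_concat {a : Letter} (ha : a ≠ (0, false)) (L : List Letter) :
    gInvAhead (L ++ [a]) = gInvAhead L := by
  induction L with
  | nil =>
    obtain ⟨i, b⟩ := a
    fin_cases i <;> cases b <;> simp_all [gInvAhead]
  | cons c L ih =>
    obtain ⟨i, b⟩ := c
    fin_cases i <;> cases b <;> simp_all [gInvAhead]

theorem hSign_concat_g (b : Bool) (L : List Letter) : hSign (L ++ [(0, b)]) = hSign L := by
  cases L with
  | nil => cases b <;> rfl
  | cons c L =>
    obtain ⟨i, e⟩ := c
    fin_cases i <;> cases e <;> rfl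

/-- Moving the cut over one letter changes `cutSign` by the type of that letter. -/
theorem cutSign_rotate_sub {L : List Letter} {a : Letter}
    (hr : FreeGroup.IsCyclicallyReduced (a :: L)) :
    cutSign (L ++ [a]) - cutSign (a :: L) = typeSign (positiveRotation (a :: L)) := by
  obtain ⟨i, b⟩ := a
  have hi : i = 0 ∨ i = 1 := by omega
  rcases hi with rfl | rfl
  · cases b
    · simp only [cutSign, invRev_concat, invRev_cons, bar_mk, Bool.not_false, positiveRotation,
        typeSign]
      rw [gInvAhead_concat (a := (0, true)) (by decide),
        show hSign ((0, false) :: L) = 0 from rfl, if_pos rfl]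
      simp [gInvAhead, hSign_concat_g]
    · simp only [cutSign, invRev_concat, invRev_cons, bar_mk, Bool.not_true, positiveRotation,
        typeSign]
      rw [gInvAhead_concat (a := (0, true)) (by decide), hSign_concat_g]
      simp only [gInvAhead, hSign]
      split_ifs with h0 <;> simp [h0]
  · have h0 : typeSign (positiveRotation ((1, b) :: L)) = 0 := by cases b <;> rfl
    have h1 : gInvAhead (L ++ [(1, b)]) = gInvAhead L := gInvAhead_concat (by simp) L
    have h2 : gInvAhead (FreeGroup.invRev L ++ [(1, !b)]) = gInvAhead (FreeGroup.invRev L) :=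
      gInvAhead_concat (by simp) _
    have h3 : ∀ (e : Bool) (M : List Letter), gInvAhead ((1, e) :: M) = gInvAhead M :=
      fun e M => rfl
    have h4 : (if hSign (L ++ [(1, b)]) = 0 then -hSign ((1, !b) :: FreeGroup.invRev L)
        else hSign (L ++ [(1, b)])) = hSign ((1, b) :: L) := by
      cases L with
      | nil => cases b <;> simp [hSign]
      | cons c L =>
        obtain ⟨j, e⟩ := c
        have h5 := hr.isReduced
        rw [FreeGroup.isReduced_cons_cons] at h5
        have h6 := h5.1
        have hj : j = 0 ∨ j = 1 := by omega
        rcases hj with rfl | rfl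
        · cases b <;> cases e <;> simp [hSign]
        · have h7 : b = e := h6 rfl
          subst h7
          cases b <;> simp [hSign]
    have h5 : hSign ((1, b) :: L) ≠ 0 := by cases b <;> simp [hSign]
    simp only [cutSign, invRev_concat, invRev_cons, bar_mk]
    rw [h0, h1, h2, h3, h3, h4, if_neg h5, sub_self]

theorem isCyclicallyReduced_rotate {L : List Letter} (hr : FreeGroup.IsCyclicallyReduced L)
    (j : ℕ) : FreeGroup.IsCyclicallyReduced (L.rotate j) := by
  induction j with
  | zero => simpa using hr
  | succ j ih =>
    rw [← List.rotate_rotate]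
    cases hL : L.rotate j with
    | nil => simp
    | cons a M =>
      rw [hL] at ih
      simpa using isCyclicallyReduced_append_comm (L := [a]) (M := M) ih

/-- Among the words beginning with `g` that are rotations of a cyclic word or of its inverse, as
many begin with some `g hⁱ g⁻¹` as with some `g h⁻ⁱ g⁻¹`, `i > 0`. -/
theorem sum_typeSign {L : List Letter} (hr : FreeGroup.IsCyclicallyReduced L) :
    ∑ j ∈ Finset.range L.length, typeSign (positiveRotation (L.rotate j)) = 0 := by
  have h1 : ∀ j ∈ Finset.range L.length, typeSign (positiveRotation (L.rotate j)) =
      cutSign (L.rotate (j + 1)) - cutSign (L.rotate j) := by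
    intro j hj
    have h2 := isCyclicallyReduced_rotate hr j
    rw [← List.rotate_rotate]
    cases hL : L.rotate j with
    | nil =>
      have h3 := congrArg List.length hL
      rw [List.length_rotate, List.length_nil] at h3
      simp [h3] at hj
    | cons a M =>
      rw [hL] at h2
      rw [← cutSign_rotate_sub h2]
      simp
  rw [Finset.sum_congr rfl h1, Finset.sum_range_sub (fun j => cutSign (L.rotate j))]
  simp

/-! ### Positivity of short words -/

/-- The sign conditions on a translational part `x` of `g` that make the Margulis invariants of the
words of length at most `k + 1` nonnegative, if the translational part of `h` is zero. -/
structure IsAdmissible (g h : R21 ≃ₗ[ℝ] R21) (k : ℕ) (x : R21) : Prop where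
  ghWord_pos : ∀ i ≤ k, 0 < ldot x (xZero (wordMap g h (ghWord i)))
  ghWord_g_pos : ∀ i < k, ∀ N, FreeGroup.IsCyclicallyReduced (ghWord i ++ (0, true) :: N) →
    0 < ldot x (xZero (wordMap g h (ghWord i ++ (0, true) :: N)))
  g_h_inv_pos : 1 ≤ k → ∀ N, FreeGroup.IsCyclicallyReduced ((0, true) :: (1, false) :: N) →
    0 < ldot x (xZero (wordMap g h ((0, true) :: (1, false) :: N)))
  propertyC : 1 ≤ k → ∀ w₁ ∈ wordSet true, ∀ w₂ ∈ wordSet false,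
    -ldot x (xZero (eval g h w₁)) < ldot x (xZero (eval g h w₂))

theorem IsAdmissible.add {g h : R21 ≃ₗ[ℝ] R21} {k : ℕ} {x y : R21} (hx : IsAdmissible g h k x)
    (hy : IsAdmissible g h k y) {r s : ℝ} (hr : 0 < r) (hs : 0 < s) :
    IsAdmissible g h k (r • x + s • y) := by
  have key : ∀ z, 0 < ldot x z → 0 < ldot y z → 0 < ldot (r • x + s • y) z := fun z h1 h2 => by
    rw [ldot_add_left, ldot_smul_left, ldot_smul_left]
    exact add_pos (mul_pos hr h1) (mul_pos hs h2)
  refine ⟨fun i hi => key _ (hx.1 i hi) (hy.1 i hi), fun i hi N hN =>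
    key _ (hx.2 i hi N hN) (hy.2 i hi N hN), fun hk N hN => key _ (hx.3 hk N hN) (hy.3 hk N hN),
    fun hk w₁ h₁ w₂ h₂ => ?_⟩
  have h3 := mul_lt_mul_of_pos_left (hx.4 hk w₁ h₁ w₂ h₂) hr
  have h4 := mul_lt_mul_of_pos_left (hy.4 hk w₁ h₁ w₂ h₂) hs
  simp only [ldot_add_left, ldot_smul_left]
  linarith

theorem exists_replicate_append (a : Letter) (N : List Letter) :
    ∃ i M, N = List.replicate i a ++ M ∧ M.head? ≠ some a := by
  induction N with
  | nil => exact ⟨0, [], rfl, by simp⟩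
  | cons b N ih =>
    by_cases hb : b = a
    · obtain ⟨i, M, rfl, hM⟩ := ih
      exact ⟨i + 1, M, by rw [hb, List.replicate_succ, List.cons_append], hM⟩
    · exact ⟨0, b :: N, rfl, by simpa using hb⟩

theorem gInvAhead_replicate_append (b : Bool) (i : ℕ) (N : List Letter) :
    gInvAhead (List.replicate i (1, b) ++ N) = gInvAhead N := by
  induction i with
  | zero => rfl
  | succ i ih => rw [List.replicate_succ, List.cons_append, gInvAhead, ih]

theorem mk_mem_wordSet {e : Bool} {i : ℕ} (hi : 0 < i) {M : List Letter}
    (hr : FreeGroup.IsCyclicallyReduced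
      ((0, true) :: (List.replicate i (1, e) ++ (0, false) :: M))) :
    FreeGroup.mk ((0, true) :: (List.replicate i (1, e) ++ (0, false) :: M)) ∈ wordSet e := by
  have h1 : (FreeGroup.mk ((0, true) :: (List.replicate i (1, e) ++ (0, false) :: M))).toWord
      = (0, true) :: (List.replicate i (1, e) ++ (0, false) :: M) := by
    rw [FreeGroup.toWord_mk, hr.isReduced.reduce_eq]
  refine ⟨by rw [h1]; exact hr, i, hi, ?_⟩
  rw [h1]
  exact ⟨M, by simp⟩

theorem not_isReduced_cancel (L N : List Letter) (a : Letter) :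
    ¬ FreeGroup.IsReduced (L ++ a :: bar a :: N) := fun hr => by
  have := hr.infix (L₁ := [a, bar a]) ⟨L, N, by simp⟩
  rw [FreeGroup.isReduced_cons_cons, letter_rel_iff] at this
  exact this.1 rfl

/-- The words of positive, negative and vanishing type that begin with `g`. -/
theorem typeSign_cases {k : ℕ} {N : List Letter} (hlen : N.length ≤ k)
    (hr : FreeGroup.IsCyclicallyReduced ((0, true) :: N)) :
    (typeSign ((0, true) :: N) = 0 ∧ ((∃ i ≤ k, (0, true) :: N = ghWord i) ∨
      (∃ i < k, ∃ M, (0, true) :: N = ghWord i ++ (0, true) :: M) ∨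
      (1 ≤ k ∧ ∃ M, N = (1, false) :: M))) ∨
    (typeSign ((0, true) :: N) = -1 ∧ 1 ≤ k ∧ FreeGroup.mk ((0, true) :: N) ∈ wordSet true) ∨
    (typeSign ((0, true) :: N) = 1 ∧ 1 ≤ k ∧ FreeGroup.mk ((0, true) :: N) ∈ wordSet false) := by
  have hred := hr.isReduced
  obtain ⟨i, M, rfl, hM⟩ := exists_replicate_append (1, true) N
  rw [List.length_append, List.length_replicate] at hlen
  rcases M with _ | ⟨⟨j, b⟩, M⟩
  · refine Or.inl ⟨?_, Or.inl ⟨i, by simpa using hlen, by simp⟩⟩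
    rw [typeSign, gInvAhead_replicate_append]; simp [gInvAhead]
  rw [List.length_cons] at hlen
  have hj : j = 0 ∨ j = 1 := by omega
  rcases hj with rfl | rfl <;> cases b
  · rcases Nat.eq_zero_or_pos i with rfl | hi
    · exact absurd hred (not_isReduced_cancel [] M (0, true))
    · refine Or.inr (Or.inl ⟨?_, by omega, mk_mem_wordSet hi hr⟩)
      obtain ⟨i, rfl⟩ := Nat.exists_eq_add_of_le' hi
      rw [typeSign, gInvAhead_replicate_append, List.replicate_succ, List.cons_append]
      simp [gInvAhead, hSign]
  · refine Or.inl ⟨?_, Or.inr (Or.inl ⟨i, by omega, M, by simp⟩)⟩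
    rw [typeSign, gInvAhead_replicate_append]; simp [gInvAhead]
  · rcases Nat.eq_zero_or_pos i with rfl | hi
    · simp only [List.replicate_zero, List.nil_append] at *
      obtain ⟨i, M', hM', hhead⟩ := exists_replicate_append (1, false) ((1, false) :: M)
      have hi : 0 < i := by
        rcases Nat.eq_zero_or_pos i with rfl | hi
        · rw [List.replicate_zero, List.nil_append] at hM'
          rw [← hM'] at hhead
          simp at hhead
        · exact hi
      have hts : typeSign ((0, true) :: (1, false) :: M) = gInvAhead M' := by
        rw [typeSign, show hSign ((1, false) :: M) = -1 from rfl, hM', gInvAhead_replicate_append]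
        ring
      have hneutral : gInvAhead M' = 0 → (typeSign ((0, true) :: (1, false) :: M) = 0 ∧
          ((∃ i ≤ k, (0, true) :: (1, false) :: M = ghWord i) ∨
          (∃ i < k, ∃ L, (0, true) :: (1, false) :: M = ghWord i ++ (0, true) :: L) ∨
          (1 ≤ k ∧ ∃ L, ((1, false) :: M : List Letter) = (1, false) :: L))) := fun h0 =>
        ⟨hts.trans h0, Or.inr (Or.inr ⟨by omega, M, rfl⟩)⟩
      rcases M' with _ | ⟨⟨j, b⟩, M'⟩
      · exact Or.inl (hneutral rfl)
      have hj : j = 0 ∨ j = 1 := by omega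
      rcases hj with rfl | rfl <;> cases b
      · refine Or.inr (Or.inr ⟨hts, by omega, ?_⟩)
        rw [hM'] at hr ⊢
        exact mk_mem_wordSet hi hr
      · exact Or.inl (hneutral rfl)
      · simp at hhead
      · rw [hM'] at hred
        obtain ⟨i, rfl⟩ := Nat.exists_eq_add_of_le' hi
        rw [List.replicate_succ', List.append_assoc, ← List.cons_append] at hred
        exact absurd hred (not_isReduced_cancel _ M' (1, false))
    · obtain ⟨i, rfl⟩ := Nat.exists_eq_add_of_le' hi
      rw [List.replicate_succ', List.append_assoc, ← List.cons_append] at hred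
      exact absurd hred (not_isReduced_cancel _ M (1, true))
  · simp at hM

/-- Property C provides a constant `c` that separates the possibly negative contributions from the
compensating ones. -/
theorem exists_separating_constant {g h : R21 ≃ₗ[ℝ] R21} {k : ℕ} {x : R21}
    (hx : IsAdmissible g h k x) : ∃ c : ℝ, ∀ N : List Letter, N.length ≤ k →
      FreeGroup.IsCyclicallyReduced ((0, true) :: N) →
      c * typeSign ((0, true) :: N) < ldot x (xZero (wordMap g h ((0, true) :: N))) := by
  have hfin := List.finite_length_le Letter k
  set X : List Letter → ℝ := fun N => ldot x (xZero (wordMap g h ((0, true) :: N))) with hX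
  set S : Bool → Set (List Letter) := fun e =>
    {N | N.length ≤ k ∧ 1 ≤ k ∧ FreeGroup.mk ((0, true) :: N) ∈ wordSet e} with hS
  have hSfin : ∀ e, (S e).Finite := fun e => hfin.subset fun N hN => hN.1
  obtain ⟨c, hc1, hc2⟩ := Order.exists_between_finsets
    ((hSfin true).toFinset.image fun N => -X N) ((hSfin false).toFinset.image X) (by
      intro y hy z hz
      simp only [Finset.mem_image, Set.Finite.mem_toFinset] at hy hz
      obtain ⟨N, hN, rfl⟩ := hy
      obtain ⟨M, hM, rfl⟩ := hz
      exact hx.propertyC hN.2.1 _ hN.2.2 _ hM.2.2)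
  refine ⟨c, fun N hN hr => ?_⟩
  rcases typeSign_cases hN hr with ⟨h0, hcase⟩ | ⟨h0, hk, hw⟩ | ⟨h0, hk, hw⟩
  · rw [h0, mul_zero]
    rcases hcase with ⟨i, hi, hNi⟩ | ⟨i, hi, M, hNi⟩ | ⟨hk, M, rfl⟩
    · rw [hNi]; exact hx.ghWord_pos i hi
    · rw [hNi] at hr ⊢; exact hx.ghWord_g_pos i hi M hr
    · exact hx.g_h_inv_pos hk M hr
  · have h1 := hc1 (-X N) (Finset.mem_image.2 ⟨N, (hSfin true).mem_toFinset.2 ⟨hN, hk, hw⟩, rfl⟩)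
    rw [h0]; simp only [hX] at h1; linarith
  · have h1 := hc2 (X N) (Finset.mem_image.2 ⟨N, (hSfin false).mem_toFinset.2 ⟨hN, hk, hw⟩, rfl⟩)
    rw [h0]; simp only [hX] at h1; linarith

namespace PingPong

variable {g h : R21 ≃ₗ[ℝ] R21} {A : Letter → Set R21}

/-- The contributions exceed a multiple of `typeSign`, whose sum is zero. Letters `h` and `h⁻¹` do
not contribute. -/
theorem wordMargulis_pos (P : PingPong g h A) {k : ℕ} {x : R21} (hx : IsAdmissible g h k x)
    {L : List Letter} (hr : FreeGroup.IsCyclicallyReduced L) (hlen : L.length ≤ k + 1)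
    (hg : ∃ b, ((0, b) : Letter) ∈ L) : 0 < wordMargulis g h ![x, 0] L := by
  obtain ⟨c, hc⟩ := exists_separating_constant hx
  have hzero : ∑ j ∈ Finset.range L.length, c * typeSign (positiveRotation (L.rotate j)) = 0 := by
    rw [← Finset.mul_sum, sum_typeSign hr, mul_zero]
  rw [P.wordMargulis_eq_sum _ hr, ← hzero]
  have hlt : ∀ b M, FreeGroup.IsCyclicallyReduced ((0, b) :: M) → M.length ≤ k →
      c * typeSign (positiveRotation ((0, b) :: M)) < headTerm g h ![x, 0] ((0, b) :: M) := by
    intro b M hM hMk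
    have h1 := isCyclicallyReduced_positiveRotation hM
    cases b
    · exact hc _ (by simpa using hMk) h1
    · exact hc _ hMk h1
  have hlen' : ∀ j a M, L.rotate j = a :: M → M.length ≤ k := fun j a M hj => by
    have h1 := congrArg List.length hj
    rw [List.length_rotate, List.length_cons] at h1
    omega
  refine Finset.sum_lt_sum (fun j _ => ?_) ?_
  · have hrj := isCyclicallyReduced_rotate hr j
    cases hL : L.rotate j with
    | nil => simp [positiveRotation, typeSign, headTerm]
    | cons a M =>
      rw [hL] at hrj
      obtain ⟨i, b⟩ := a
      have hi : i = 0 ∨ i = 1 := by omega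
      rcases hi with rfl | rfl
      · exact (hlt b M hrj (hlen' j _ M hL)).le
      · refine le_of_eq ?_
        have h0 : typeSign (positiveRotation ((1, b) :: M)) = 0 := by cases b <;> rfl
        rw [h0]
        simp [headTerm, ldot]
  · obtain ⟨b, hb⟩ := hg
    obtain ⟨M, N, rfl⟩ := List.append_of_mem hb
    refine ⟨M.length, by simp, ?_⟩
    have hrj := isCyclicallyReduced_rotate hr M.length
    have hlj := hlen' M.length (0, b) (N ++ M)
    rw [List.rotate_append_length_eq, List.cons_append] at hrj hlj ⊢
    exact hlt b _ hrj (hlj rfl)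

/-- On words in `h` only, the Margulis invariant is determined by the translational part of `h`. -/
theorem wordMargulis_hWord_pos (P : PingPong g h A) {x : R21} {ε : ℝ} (hε : 0 < ε)
    {L : List Letter} (hr : FreeGroup.IsCyclicallyReduced L) (hL : L ≠ [])
    (hg : ¬ ∃ b, ((0, b) : Letter) ∈ L) : 0 < wordMargulis g h ![x, ε • xZero h] L := by
  have hax := P.isAxisPair (FreeGroup.IsCyclicallyReduced.singleton (x := ((1, true) : Letter)))
  rw [wordMap_h] at hax
  have hpow : ∀ m : ℕ, xZero (wordMap g h (hWord (m + 1))) = xZero h := by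
    intro m
    suffices IsAxisPair (wordMap g h (hWord (m + 1))) (xMinus h) (xPlus h) by
      rw [this.frame_eq.1, hax.frame_eq.1]
    obtain ⟨hh, hm, hp, l, l0, l1, em, ep⟩ := hax
    refine ⟨P.isSO21 _, hm, hp, l ^ (m + 1), pow_pos l0 _, pow_lt_one₀ l0.le l1 (by omega), ?_, ?_⟩
    · generalize m + 1 = n
      induction n with
      | zero => simp [wordMap_nil_apply]
      | succ n ih =>
        rw [hWord, List.replicate_succ, wordMap_cons_apply, ih, wordMap_h, map_smul, em, smul_smul,
          pow_succ]
    · generalize m + 1 = n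
      induction n with
      | zero => simp [wordMap_nil_apply]
      | succ n ih =>
        rw [hWord, List.replicate_succ, wordMap_cons_apply, ih, wordMap_h, map_smul, ep, smul_smul,
          pow_succ, mul_inv]
  have hrep : ∀ M : List Letter, FreeGroup.IsReduced M → (∀ b, ((0, b) : Letter) ∉ M) →
      ∃ b, M = List.replicate M.length (1, b) := by
    intro M
    induction M with
    | nil => intro _ _; exact ⟨true, rfl⟩
    | cons a M ih =>
      intro hM hg
      obtain ⟨i, b⟩ := a
      have hi : i = 0 ∨ i = 1 := by omega
      rcases hi with rfl | rfl
      · exact absurd List.mem_cons_self (hg b)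
      · refine ⟨b, ?_⟩
        obtain ⟨e, he⟩ := ih (hM.infix ⟨[(1, b)], [], by simp⟩)
          fun b hb => hg b (List.mem_cons_of_mem _ hb)
        rw [List.length_cons, List.replicate_succ]
        congr 1
        cases M with
        | nil => rfl
        | cons c M =>
          rw [FreeGroup.isReduced_cons_cons] at hM
          rw [List.length_cons, List.replicate_succ] at he ⊢
          have hc := (List.cons.inj he).1
          subst hc
          have : b = e := hM.1 rfl
          rw [this]
          exact he
  push Not at hg
  obtain ⟨b, hb⟩ := hrep L hr.isReduced hg
  rw [P.wordMargulis_eq_sum _ hr]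
  have hlen : 0 < L.length := List.length_pos_iff.2 hL
  refine Finset.sum_pos (fun j _ => ?_) ⟨0, Finset.mem_range.2 hlen⟩
  obtain ⟨n, hn⟩ := Nat.exists_eq_add_of_le' hlen
  rw [hn] at hb
  have hpos : positiveRotation (L.rotate j) = hWord (n + 1) := by
    rw [hb, List.rotate_replicate, List.replicate_succ]
    cases b
    · simp [positiveRotation, FreeGroup.invRev, hWord, List.replicate_succ]
    · rfl
  have hterm : headTerm g h ![x, ε • xZero h] (L.rotate j)
      = ldot (ε • xZero h) (xZero (wordMap g h (hWord (n + 1)))) := by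
    rw [← hpos, hb, List.rotate_replicate, List.replicate_succ]
    rfl
  rw [hterm, hpow, ldot_smul_left, hax.frame_eq.1, ldot_axis_self hax.left_mem hax.ldot_neg, mul_one]
  exact hε

/-! ### Both endpoints of the segment are admissible -/

theorem isAdmissible_points (P : PingPong g h A) (O : IsOriented A)
    (hC : PropertyCIneq g h (A (0, true))) (k : ℕ) :
    IsAdmissible g h k (lowerPoint g h k) ∧ IsAdmissible g h k (upperPoint g h k) :=
  ⟨⟨fun _ hi => (P.ldot_ghWord_pos O hi).1, fun _ hi _ hN => (P.ldot_ghWord_append_g_pos O hi hN).1,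
      fun hk _ hN => (P.ldot_g_h_inv_pos O hk hN).1,
      fun hk => hC _ (P.points_mem_intervalIn O hk).1⟩,
    ⟨fun _ hi => (P.ldot_ghWord_pos O hi).2, fun _ hi _ hN => (P.ldot_ghWord_append_g_pos O hi hN).2,
      fun hk _ hN => (P.ldot_g_h_inv_pos O hk hN).2,
      fun hk => hC _ (P.points_mem_intervalIn O hk).2⟩⟩

end PingPong

/-! ### Affine deformations -/

theorem affine_apply (γ : R21 ≃ᵃ[ℝ] R21) (x : R21) : γ x = γ.linear x + γ 0 := by
  have := γ.map_vadd 0 x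
  simpa using this

theorem evalAffine_linear {g h : R21 ≃ₗ[ℝ] R21} {γ η : R21 ≃ᵃ[ℝ] R21} (hγ : γ.linear = g)
    (hη : η.linear = h) (w : FreeGroup (Fin 2)) : (evalAffine γ η w).linear = eval g h w := by
  have key : (AffineEquiv.linearHom : (R21 ≃ᵃ[ℝ] R21) →* (R21 ≃ₗ[ℝ] R21)).comp (evalAffine γ η)
      = eval g h := by
    refine FreeGroup.ext_hom _ _ fun i => ?_
    fin_cases i
    · simpa [evalAffine, eval] using hγ
    · simpa [evalAffine, eval] using hη
  exact DFunLike.congr_fun key w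

theorem evalAffine_mk_zero {g h : R21 ≃ₗ[ℝ] R21} {γ η : R21 ≃ᵃ[ℝ] R21} (hγ : γ.linear = g)
    (hη : η.linear = h) (L : List Letter) :
    evalAffine γ η (FreeGroup.mk L) 0 = trans g h ![γ 0, η 0] L := by
  induction L with
  | nil => rw [← FreeGroup.one_eq_mk, map_one]; rfl
  | cons a L ih =>
    have h1 : FreeGroup.mk (a :: L) = FreeGroup.mk [a] * FreeGroup.mk L := by
      rw [FreeGroup.mul_mk]; rfl
    rw [h1, map_mul, AffineEquiv.mul_def, AffineEquiv.trans_apply, ih, affine_apply,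
      evalAffine_linear hγ hη, trans, add_comm]
    congr 1
    have hinv : ∀ δ : R21 ≃ᵃ[ℝ] R21, δ⁻¹ 0 = -(δ.linear⁻¹ (δ 0)) := fun δ => by
      have h2 : δ (δ⁻¹ 0) = 0 := δ.apply_symm_apply 0
      rw [affine_apply] at h2
      have h3 : δ.linear⁻¹ (δ.linear (δ⁻¹ 0)) = δ⁻¹ 0 := δ.linear.symm_apply_apply _
      rw [← h3, eq_neg_of_add_eq_zero_left h2, map_neg]
    obtain ⟨i, b⟩ := a
    have hi : i = 0 ∨ i = 1 := by omega
    rcases hi with rfl | rfl <;> cases b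
    · simpa [evalAffine, letterTrans, wordMap_g_inv, hγ] using hinv γ
    · simp [evalAffine, letterTrans]
    · simpa [evalAffine, letterTrans, wordMap_h_inv, hη] using hinv η
    · simp [evalAffine, letterTrans]

theorem margulis_evalAffine {g h : R21 ≃ₗ[ℝ] R21} {γ η : R21 ≃ᵃ[ℝ] R21} (hγ : γ.linear = g)
    (hη : η.linear = h) (L : List Letter) :
    margulis (evalAffine γ η (FreeGroup.mk L)) = wordMargulis g h ![γ 0, η 0] L := by
  rw [margulis, evalAffine_mk_zero hγ hη, evalAffine_linear hγ hη, sub_zero]; rfl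

theorem margulis_conj {γ δ : R21 ≃ᵃ[ℝ] R21} {m p : R21} (hγ : IsAxisPair γ.linear m p)
    (hδ : IsSO21 δ.linear) : margulis (δ * γ * δ⁻¹) = margulis γ := by
  have hlin : (δ * γ * δ⁻¹).linear = δ.linear * γ.linear * δ.linear⁻¹ := rfl
  rw [margulis, margulis, hlin, xZero_conj hγ hδ, sub_zero, sub_zero]
  have h1 : (δ * γ * δ⁻¹) 0 = δ.linear (γ (δ⁻¹ 0)) + δ 0 := affine_apply δ _
  have h2 : δ.linear (δ⁻¹ 0) + δ 0 = 0 := by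
    rw [← affine_apply]; exact δ.apply_symm_apply 0
  rw [h1, eq_neg_of_add_eq_zero_right h2, ← sub_eq_add_neg, ← map_sub, hδ.isometry, affine_apply γ,
    sub_eq_add_neg, ldot_add_left, ldot_add_left, ldot_neg_left]
  have h3 : γ.linear (xZero γ.linear) = xZero γ.linear := by
    rw [hγ.frame_eq.1, hγ.map_axis]
  have h4 := hγ.isSO21.isometry (δ⁻¹ 0) (xZero γ.linear)
  rw [h3] at h4
  rw [h4]; ring

/-- The affine isometry with given linear and translational part. -/
def affineOf (g : R21 ≃ₗ[ℝ] R21) (v : R21) : R21 ≃ᵃ[ℝ] R21 :=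
  g.toAffineEquiv.trans (AffineEquiv.constVAdd ℝ R21 v)

theorem affineOf_linear (g : R21 ≃ₗ[ℝ] R21) (v : R21) : (affineOf g v).linear = g := rfl

theorem affineOf_zero (g : R21 ≃ₗ[ℝ] R21) (v : R21) : affineOf g v 0 = v := by
  simp [affineOf]

theorem trans_ghWord (g h : R21 ≃ₗ[ℝ] R21) (x : R21) (i : ℕ) :
    trans g h ![x, 0] (ghWord i) = x := by
  have : ∀ i, trans g h ![x, 0] (hWord i) = 0 := fun i => by
    induction i with
    | zero => rfl
    | succ i ih => rw [hWord, List.replicate_succ, trans, ih]; simp [letterTrans]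
  rw [ghWord, trans, this]
  simp [letterTrans]

/-- Every word is conjugate to a cyclically reduced word that is not longer. -/
theorem exists_conj_cyclicallyReduced {w : FreeGroup (Fin 2)} (hw : w ≠ 1) :
    ∃ (c : FreeGroup (Fin 2)) (a : Letter) (L : List Letter),
      FreeGroup.IsCyclicallyReduced (a :: L) ∧ (a :: L).length ≤ w.norm ∧
        w = c * FreeGroup.mk (a :: L) * c⁻¹ := by
  have h1 := FreeGroup.reduceCyclically.conj_conjugator_reduceCyclically w.toWord
  have h2 := FreeGroup.reduceCyclically.isCyclicallyReduced (FreeGroup.isReduced_toWord (x := w))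
  have h3 : w = FreeGroup.mk (FreeGroup.reduceCyclically.conjugator w.toWord) *
      FreeGroup.mk (FreeGroup.reduceCyclically w.toWord) *
      (FreeGroup.mk (FreeGroup.reduceCyclically.conjugator w.toWord))⁻¹ := by
    rw [FreeGroup.inv_mk, FreeGroup.mul_mk, FreeGroup.mul_mk, h1, FreeGroup.mk_toWord]
  cases hL : FreeGroup.reduceCyclically w.toWord with
  | nil =>
    rw [hL, ← FreeGroup.one_eq_mk] at h3
    exact absurd (by rw [h3]; group) hw
  | cons a L =>
    rw [hL] at h2 h3
    refine ⟨_, a, L, h2, ?_, h3⟩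
    have h4 := congrArg List.length h1
    rw [hL, List.length_append, List.length_append] at h4
    rw [FreeGroup.norm]
    omega

namespace PingPong

variable {g h : R21 ≃ₗ[ℝ] R21} {A : Letter → Set R21}

theorem wordMargulis_ghWord_append (P : PingPong g h A) (x : R21) (i j : ℕ) :
    wordMargulis g h ![x, 0] (ghWord i ++ ghWord j) =
      ldot x (xZero (wordMap g h (ghWord i ++ ghWord j))) +
        ldot x (xZero (wordMap g h (ghWord j ++ ghWord i))) := by
  have hax := P.isAxisPair (L := hWord i ++ ghWord j) (isCyclicallyReduced_ghWord_append i j)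
  have h1 := xZero_conj hax (P.isSO21 (ghWord i)).inv
  have h2 : (wordMap g h (ghWord i))⁻¹ * wordMap g h ((0, true) :: (hWord i ++ ghWord j)) *
      (wordMap g h (ghWord i))⁻¹⁻¹ = wordMap g h (ghWord j ++ ghWord i) := by
    rw [← List.cons_append, wordMap_append, wordMap_append, inv_mul_cancel_left, inv_inv]
  rw [h2] at h1
  rw [wordMargulis, trans_append, trans_ghWord, trans_ghWord, ldot_add_left,
    (P.isSO21 _).ldot_inv_left, h1, List.cons_append]

/-- The Margulis invariant is invariant under conjugation, so that cyclically reduced words decide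
the signs on all words up to a given length. -/
theorem isHyperbolic_and_margulis_pos (P : PingPong g h A) {n : ℕ} {v : Fin 2 → R21}
    (hv : ∀ (a : Letter) (L : List Letter), FreeGroup.IsCyclicallyReduced (a :: L) →
      (a :: L).length ≤ n → 0 < wordMargulis g h v (a :: L))
    (w : FreeGroup (Fin 2)) (hw : w ≠ 1) (hwn : w.norm ≤ n) :
    IsHyperbolic (evalAffine (affineOf g (v 0)) (affineOf h (v 1)) w).linear ∧
      0 < margulis (evalAffine (affineOf g (v 0)) (affineOf h (v 1)) w) := by
  obtain ⟨c, a, L, hr, hlen, rfl⟩ := exists_conj_cyclicallyReduced hw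
  have hlin := evalAffine_linear (affineOf_linear g (v 0)) (affineOf_linear h (v 1))
  have hax := P.isAxisPair hr
  have hc : IsSO21 (eval g h c) := by
    have := P.isSO21 c.toWord
    rwa [wordMap, FreeGroup.mk_toWord] at this
  constructor
  · rw [hlin, map_mul, map_mul, map_inv]
    exact (hax.conj hc).isHyperbolic
  · have h1 := margulis_conj (γ := evalAffine (affineOf g (v 0)) (affineOf h (v 1))
      (FreeGroup.mk (a :: L))) (δ := evalAffine (affineOf g (v 0)) (affineOf h (v 1)) c)
      (by rw [hlin]; exact hax) (by rw [hlin]; exact hc)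
    rw [map_mul, map_mul, map_inv, h1,
      margulis_evalAffine (affineOf_linear g (v 0)) (affineOf_linear h (v 1)), affineOf_zero,
      affineOf_zero]
    have h2 : ![v 0, v 1] = v := by ext i; fin_cases i <;> rfl
    rw [h2]
    exact hv a L hr (hlen.trans hwn)

/-- Translational parts for which the word `g hᵏ⁺¹ g hᵏ` has Margulis invariant zero, the word
`g hᵏ⁺¹` a negative one, and every word of length at most `k + 1` a positive one. With the
translational part of `h` equal to zero, all conditions except positivity on the powers of `h` hold
at a point of the segment from `lowerPoint` to `upperPoint`; a small perturbation in the direction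
of `xZero h` makes the powers of `h` positive as well. -/
theorem exists_translations (P : PingPong g h A) (O : IsOriented A)
    (hC : PropertyCIneq g h (A (0, true))) (k : ℕ) : ∃ v : Fin 2 → R21,
      (∀ (a : Letter) (L : List Letter), FreeGroup.IsCyclicallyReduced (a :: L) →
        (a :: L).length ≤ k + 1 → 0 < wordMargulis g h v (a :: L)) ∧
      wordMargulis g h v (ghWord (k + 1)) < 0 ∧
      wordMargulis g h v (ghWord (k + 1) ++ ghWord k) = 0 := by
  set W := ghWord (k + 1) ++ ghWord k with hW
  set x := lowerPoint g h k with hx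
  set y := upperPoint g h k with hy
  have hWx : wordMargulis g h ![x, 0] W < 0 := by
    rw [hW, P.wordMargulis_ghWord_append, P.ldot_lowerPoint_eq_zero, add_zero]
    exact P.ldot_lowerPoint_neg O k
  have hWy : 0 < wordMargulis g h ![y, 0] W := by
    rw [hW, P.wordMargulis_ghWord_append]
    exact add_pos (P.ldot_upperPoint_swap_pos O k) (P.ldot_upperPoint_pos O k)
  -- The point of the segment at which the Margulis invariant of `W` vanishes.
  set r := wordMargulis g h ![y, 0] W with hr
  set s := -wordMargulis g h ![x, 0] W with hs
  have hs0 : 0 < s := neg_pos.2 hWx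
  set z := r • x + s • y with hz
  have hadm : IsAdmissible g h k z :=
    (P.isAdmissible_points O hC k).1.add (P.isAdmissible_points O hC k).2 hWy hs0
  have hsplit : ∀ (a b : ℝ) (L : List Letter), wordMargulis g h ![a • x + b • y, 0] L =
      a * wordMargulis g h ![x, 0] L + b * wordMargulis g h ![y, 0] L := by
    intro a b L
    have h0 : wordMargulis g h (0 : Fin 2 → R21) L = 0 := by
      have := wordMargulis_add_smul g h 0 0 1 L
      simp only [smul_zero, add_zero] at this
      linarith
    have h1 : ![a • x + b • y, 0] = (0 + a • ![x, 0]) + b • ![y, (0 : R21)] := by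
      ext i j; fin_cases i <;> simp
    rw [h1, wordMargulis_add_smul, wordMargulis_add_smul, h0, zero_add]
  have hzW : wordMargulis g h ![z, 0] W = 0 := by
    rw [hz, hsplit, ← hr, hs]; ring
  have hzneg : wordMargulis g h ![z, 0] (ghWord (k + 1)) < 0 := by
    rw [wordMargulis, trans_ghWord, hz, ldot_add_left, ldot_smul_left, ldot_smul_left,
      P.ldot_upperPoint_ghWord_succ, mul_zero, add_zero]
    exact mul_neg_of_pos_of_neg hWy (P.ldot_lowerPoint_ghWord_succ_neg O k)
  -- The direction of a perturbation that keeps the Margulis invariant of `W` equal to zero.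
  set q : Fin 2 → R21 := ![(-(wordMargulis g h ![0, xZero h] W) / r) • y, xZero h] with hq
  have hqW : wordMargulis g h q W = 0 := by
    have h1 : q = ![0, xZero h] + (-(wordMargulis g h ![0, xZero h] W) / r) • ![y, (0 : R21)] := by
      ext i j; fin_cases i <;> simp [hq]
    rw [h1, wordMargulis_add_smul, ← hr]
    field_simp
    ring
  have hcont : ∀ L, Filter.Tendsto (fun ε : ℝ => wordMargulis g h (![z, 0] + ε • q) L)
      (nhdsWithin 0 (Set.Ioi 0)) (nhds (wordMargulis g h ![z, 0] L)) := by
    intro L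
    refine Filter.Tendsto.mono_left ?_ nhdsWithin_le_nhds
    simp only [wordMargulis_add_smul]
    have : Continuous fun ε : ℝ => wordMargulis g h ![z, 0] L + ε * wordMargulis g h q L := by
      fun_prop
    simpa using this.tendsto 0
  have hpos : ∀ᶠ ε : ℝ in nhdsWithin 0 (Set.Ioi 0), ∀ L ∈ {L : List Letter | L.length ≤ k + 1},
      FreeGroup.IsCyclicallyReduced L → (∃ b, ((0, b) : Letter) ∈ L) →
        0 < wordMargulis g h (![z, 0] + ε • q) L := by
    rw [Filter.eventually_all_finite (List.finite_length_le Letter (k + 1))]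
    intro L hL
    by_cases hcase : FreeGroup.IsCyclicallyReduced L ∧ ∃ b, ((0, b) : Letter) ∈ L
    · filter_upwards [(hcont L).eventually_const_lt
        (P.wordMargulis_pos hadm hcase.1 hL hcase.2)] with ε hε _ _
      exact hε
    · exact Filter.Eventually.of_forall fun ε h1 h2 => absurd ⟨h1, h2⟩ hcase
  obtain ⟨ε, hε1, hε2, hε3⟩ := (hpos.and (((hcont (ghWord (k + 1))).eventually_lt_const hzneg).and
    self_mem_nhdsWithin)).exists
  refine ⟨![z, 0] + ε • q, fun a L hr hlen => ?_, hε2, ?_⟩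
  · by_cases hg : ∃ b, ((0, b) : Letter) ∈ a :: L
    · exact hε1 _ hlen hr hg
    · have h1 : ∃ u, ![z, 0] + ε • q = ![u, ε • xZero h] :=
        ⟨(![z, 0] + ε • q) 0, by ext i j; fin_cases i <;> simp [hq]⟩
      obtain ⟨u, hu⟩ := h1
      rw [hu]
      exact P.wordMargulis_hWord_pos hε3 hr (List.cons_ne_nil a L) hg
  · rw [wordMargulis_add_smul, hzW, hqW, mul_zero, add_zero]

/-- The theorem in terms of ping-pong data, for generators in the standard order. -/
theorem exists_deformation (P : PingPong g h A) (O : IsOriented A)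
    (hC : PropertyCIneq g h (A (0, true))) {n : ℕ} (hn : 1 ≤ n) :
    ∃ γ η : R21 ≃ᵃ[ℝ] R21, γ.linear = g ∧ η.linear = h ∧
      (∀ w : FreeGroup (Fin 2), w ≠ 1 → w.norm ≤ n →
        IsHyperbolic (evalAffine γ η w).linear ∧ 0 < margulis (evalAffine γ η w)) ∧
      margulis (γ * η ^ n) < 0 ∧ ¬ ActsProperly (Subgroup.closure {γ, η}) := by
  obtain ⟨k, rfl⟩ := Nat.exists_eq_add_of_le' hn
  obtain ⟨v, hv, hneg, hzero⟩ := P.exists_translations O hC k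
  have h2 : ![v 0, v 1] = v := by ext i; fin_cases i <;> rfl
  have hmar := margulis_evalAffine (affineOf_linear g (v 0)) (affineOf_linear h (v 1))
  rw [affineOf_zero, affineOf_zero, h2] at hmar
  have hlin := evalAffine_linear (affineOf_linear g (v 0)) (affineOf_linear h (v 1))
  refine ⟨affineOf g (v 0), affineOf h (v 1), affineOf_linear _ _, affineOf_linear _ _,
    P.isHyperbolic_and_margulis_pos hv, ?_, ?_⟩
  · have h3 : affineOf g (v 0) * affineOf h (v 1) ^ (k + 1) =
        evalAffine (affineOf g (v 0)) (affineOf h (v 1)) (FreeGroup.mk (ghWord (k + 1))) := by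
      simp [evalAffine, FreeGroup.lift_mk]
    rw [h3, hmar]
    exact hneg
  · have hmem : evalAffine (affineOf g (v 0)) (affineOf h (v 1))
        (FreeGroup.mk (ghWord (k + 1) ++ ghWord k)) ∈
        Subgroup.closure {affineOf g (v 0), affineOf h (v 1)} := by
      have h3 : (evalAffine (affineOf g (v 0)) (affineOf h (v 1))).range ≤
          Subgroup.closure {affineOf g (v 0), affineOf h (v 1)} := by
        rw [evalAffine, FreeGroup.range_lift_eq_closure]
        refine Subgroup.closure_mono ?_
        rintro _ ⟨i, rfl⟩
        fin_cases i <;> simp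
      exact h3 ⟨_, rfl⟩
    refine not_actsProperly hmem (m := xMinus (wordMap g h (ghWord (k + 1) ++ ghWord k)))
      (p := xPlus (wordMap g h (ghWord (k + 1) ++ ghWord k))) ?_ ?_
    · rw [hlin]
      exact P.isAxisPair (L := hWord (k + 1) ++ ghWord k) (isCyclicallyReduced_ghWord_append _ _)
    · rw [hmar, hzero]

/-- The two orders of the generators exclude each other. -/
theorem not_posOrdered_inv (P : PingPong g h A) (O : IsOriented A) : ¬ PosOrdered g h⁻¹ := by
  intro hO
  have hgp := P.xPlus_letter_mem (0, true)
  have hgm := P.xMinus_letter_mem (0, true)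
  have hhm := P.xMinus_letter_mem (1, false)
  rw [wordMap_g] at hgp hgm
  rw [wordMap_h_inv] at hhm
  have h1 := O.gm_g_h _ hgm _ hgp _ hhm
  rw [det3_swap] at h1
  have h2 : 0 < det3 (xMinus g) (xMinus h⁻¹) (xPlus g) := hO
  linarith

end PingPong

theorem IsTransversal.inv_right {g h : R21 ≃ₗ[ℝ] R21} {A : Letter → Set R21} (P : PingPong g h A)
    (hT : IsTransversal g h) : IsTransversal g h⁻¹ := by
  have hah := P.isAxisPair (FreeGroup.IsCyclicallyReduced.singleton (x := ((1, true) : Letter)))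
  rw [wordMap_h] at hah
  obtain ⟨t, ht, hset⟩ := hT
  refine ⟨t, ht, ?_⟩
  rw [← hset, xZero_inv hah]
  simp only [ldot_neg_right, neg_eq_zero]

/-- The automorphism of the free group that inverts the second generator. -/
def invertSecond : FreeGroup (Fin 2) →* FreeGroup (Fin 2) :=
  FreeGroup.lift ![FreeGroup.of 0, (FreeGroup.of 1)⁻¹]

theorem invertSecond_invertSecond (w : FreeGroup (Fin 2)) :
    invertSecond (invertSecond w) = w := by
  have : invertSecond.comp invertSecond = MonoidHom.id _ := by
    refine FreeGroup.ext_hom _ _ fun i => ?_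
    fin_cases i <;> simp [invertSecond]
  exact DFunLike.congr_fun this w

theorem evalAffine_invertSecond (γ η : R21 ≃ᵃ[ℝ] R21) (w : FreeGroup (Fin 2)) :
    evalAffine γ η (invertSecond w) = evalAffine γ η⁻¹ w := by
  have : (evalAffine γ η).comp invertSecond = evalAffine γ η⁻¹ := by
    refine FreeGroup.ext_hom _ _ fun i => ?_
    fin_cases i <;> simp [invertSecond, evalAffine]
  exact DFunLike.congr_fun this w

theorem norm_invertSecond_le (w : FreeGroup (Fin 2)) : (invertSecond w).norm ≤ w.norm := by
  have h1 : ∀ L : List Letter, invertSecond (FreeGroup.mk L) = FreeGroup.mk (L.map swapH) := by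
    intro L
    induction L with
    | nil => rfl
    | cons a L ih =>
      have h2 : FreeGroup.mk (a :: L) = FreeGroup.mk [a] * FreeGroup.mk L := by
        rw [FreeGroup.mul_mk]; rfl
      rw [h2, map_mul, ih, List.map_cons, ← List.singleton_append, ← FreeGroup.mul_mk]
      obtain ⟨i, b⟩ := a
      fin_cases i <;> cases b <;> simp [invertSecond, swapH, bar, FreeGroup.of, FreeGroup.invRev]
  have h3 := h1 w.toWord
  rw [FreeGroup.mk_toWord] at h3
  rw [h3]
  exact FreeGroup.norm_mk_le.trans (by rw [List.length_map]; rfl)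

end FlatLorentz

end

theorem theorem1 (g h : FlatLorentz.R21 ≃ₗ[ℝ] FlatLorentz.R21)
    (AgMinus AgPlus AhMinus AhPlus : Set FlatLorentz.R21)
    (hS : FlatLorentz.IsSchottkySystem g h AgMinus AgPlus AhMinus AhPlus)
    (hT : FlatLorentz.IsTransversal g h)
    (hC : FlatLorentz.PropertyC g h AgPlus)
    (n : ℕ) (hn : 1 ≤ n) :
    ∃ γ η : FlatLorentz.R21 ≃ᵃ[ℝ] FlatLorentz.R21,
      γ.linear = g ∧ η.linear = h ∧
      (∀ w : FreeGroup (Fin 2), w ≠ 1 → w.norm ≤ n →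
        FlatLorentz.IsHyperbolic (FlatLorentz.evalAffine γ η w).linear ∧
          0 < FlatLorentz.margulis (FlatLorentz.evalAffine γ η w)) ∧
      (FlatLorentz.PosOrdered g h → FlatLorentz.margulis (γ * η ^ n) < 0) ∧
      (FlatLorentz.PosOrdered g h⁻¹ → FlatLorentz.margulis (γ * η⁻¹ ^ n) < 0) ∧
      ¬ FlatLorentz.ActsProperly (Subgroup.closure {γ, η}) := by
  have P := hS.pingPong
  rcases hC with ⟨hO, hC⟩ | ⟨hO, hC⟩
  · have O := P.isOriented hT hO
    obtain ⟨γ, η, hγ, hη, hw, hneg, hprop⟩ := P.exists_deformation O hC hn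
    exact ⟨γ, η, hγ, hη, hw, fun _ => hneg, fun h1 => absurd h1 (P.not_posOrdered_inv O), hprop⟩
  · have P' := P.swapH
    have O := P'.isOriented (hT.inv_right P) hO
    obtain ⟨γ, η, hγ, hη, hw, hneg, hprop⟩ := P'.exists_deformation O hC hn
    refine ⟨γ, η⁻¹, hγ, ?_, fun w hw1 hwn => ?_, fun h1 => ?_, fun _ => ?_, ?_⟩
    · have h1 : η⁻¹.linear = η.linear⁻¹ := rfl
      rw [h1, hη, inv_inv]
    · rw [← FlatLorentz.evalAffine_invertSecond]
      refine hw _ (fun h1 => hw1 ?_) ((FlatLorentz.norm_invertSecond_le w).trans hwn)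
      rw [← FlatLorentz.invertSecond_invertSecond w, h1, map_one]
    · have h2 := P'.not_posOrdered_inv O
      rw [inv_inv] at h2
      exact absurd h1 h2
    · rwa [inv_inv]
    · have h1 : Subgroup.closure {γ, η⁻¹} = Subgroup.closure {γ, η} := by
        rw [Set.insert_eq, Set.insert_eq, Subgroup.closure_union, Subgroup.closure_union,
          Subgroup.closure_singleton_inv]
      rwa [h1]
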